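/- Graphs are finite and may have loops and parallel edges. A biased graph $\Omega=(G,\mathcal B)$ is a graph $G$ together with a collection $\mathcal B$ of cycles of $G$ (the balanced cycles) such that no theta subgraph (two distinct vertices joined by three internally disjoint paths) contains exactly two members of $\mathcal B$. A matroid $M$ is represented by $\Omega$, written $M=F(\Omega)$, if $E(M)=E(G)$ and the circuits of $M$ are precisely the edge sets of the following subgraphs: balanced cycles; two edge-disjoint unbalanced cycles meeting in exactly one vertex; two vertex-disjoint unbalanced cycles together with a path connecting them (meeting each cycle only in one end); theta subgraphs all three of whose cycles are unbalanced. A matroidal is a pair $(M,L)$ where $M$ is a matroid and $L\subseteq E(M)$; it is frame if $M=F(\Omega)$ for some biased graph $\Omega$ in which every element of $L$ is an unbalanced loop. A minor of $(M,L)$ is any matroidal obtained by a sequence of the operations: deleting an element not in $L$, contracting an element not in $L$, removing an element from $L$ (keeping it in $M$). It is proper if it is different from $(M,L)$. Let $W_4$ be the wheel with four spokes (a hub joined to every vertex of a cycle of length 4), let $e_1,e_2$ be two opposite edges of the rim, and let $\mathcal M_8=(M(W_4),\{e_1,e_2\})$, where $M(W_4)$ is the cycle matroid of $W_4$. **Proposition.**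 The matroidal $\mathcal M_8$ is an excluded minor for the class of frame matroidals, among matroidals $(N,K)$ in which no element of $K$ is a loop of $N$. That is: neither $e_1$ nor $e_2$ is a loop of $M(W_4)$; $\mathcal M_8$ is not frame; and every proper minor $(N,K)$ of $\mathcal M_8$ in which no element of $K$ is a loop of the matroid $N$ is frame. -/

import Mathlib

open Set

namespace Graph

/-- `G.IsPathBetween x y U P`: there is a path of `G` from `x` to `y` (with no repeated vertices)
whose vertex set is `U` and whose edge set is `P`. Paths with no edges are allowed. -/
inductive IsPathBetween {α β : Type*} (G : Graph α β) : α → α → Set α → Set β → Prop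
  | nil (x : α) (hx : x ∈ G.vertexSet) : IsPathBetween G x x {x} ∅
  | cons (x y z : α) (e : β) (U : Set α) (P : Set β) (he : G.IsLink e x y) (hx : x ∉ U)
      (h : IsPathBetween G y z U P) : IsPathBetween G x z (insert x U) (insert e P)

/-- `C` is the edge set of a cycle of the multigraph `G`: the edges of a path together with one
further edge joining the two ends of the path. A loop is a cycle with one edge (the path being a
single vertex), a pair of parallel links is a cycle with two edges. -/
def IsCycleSet {α β : Type*} (G : Graph α β) (C : Set β) : Prop :=
  ∃ (x y : α) (U : Set α) (P : Set β) (f : β),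
    G.IsPathBetween x y U P ∧ G.IsLink f x y ∧ f ∉ P ∧ C = insert f P

/-- The set of vertices incident with an edge in `X`. -/
def verts {α β : Type*} (G : Graph α β) (X : Set β) : Set α := {v | ∃ e ∈ X, G.Inc e v}

/-- `P₁, P₂, P₃` are the edge sets of the three paths of a theta subgraph of `G`: three internally
disjoint (and pairwise edge-disjoint) paths between two distinct vertices. -/
def IsTheta {α β : Type*} (G : Graph α β) (P₁ P₂ P₃ : Set β) : Prop :=
  ∃ (x y : α) (U₁ U₂ U₃ : Set α), x ≠ y ∧
    G.IsPathBetween x y U₁ P₁ ∧ G.IsPathBetween x y U₂ P₂ ∧ G.IsPathBetween x y U₃ P₃ ∧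
    U₁ ∩ U₂ = {x, y} ∧ U₁ ∩ U₃ = {x, y} ∧ U₂ ∩ U₃ = {x, y} ∧
    Disjoint P₁ P₂ ∧ Disjoint P₁ P₃ ∧ Disjoint P₂ P₃

section CycleMatroid

variable {α β : Type*} {G : Graph α β}

lemma IsPathBetween.suffix {x z w : α} {U : Set α} {P : Set β}
    (h : G.IsPathBetween x z U P) (hw : w ∈ U) :
    ∃ U₁ P₁, P₁ ⊆ P ∧ G.IsPathBetween w z U₁ P₁ := by
  induction h with
  | nil x hx =>
    obtain rfl : w = x := by simpa using hw
    exact ⟨_, _, Subset.rfl, .nil _ hx⟩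
  | cons x y z e U P he hx h ih =>
    obtain rfl | hw := hw
    · exact ⟨_, _, Subset.rfl, .cons _ _ _ _ _ _ he hx h⟩
    · obtain ⟨U₁, P₁, hP, h₁⟩ := ih hw
      exact ⟨U₁, P₁, hP.trans (subset_insert _ _), h₁⟩

open Classical in
/-- The column of the mod-2 incidence matrix indexed by the edge `e`. -/
noncomputable def incVec (G : Graph α β) (e : β) : α →₀ ZMod 2 :=
  if h : ∃ p : α × α, G.IsLink e p.1 p.2 then
    Finsupp.single h.choose.1 1 + Finsupp.single h.choose.2 1 else 0

lemma incVec_eq {e : β} {x y : α} (h : G.IsLink e x y) :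
    incVec G e = Finsupp.single x 1 + Finsupp.single y 1 := by
  have hex : ∃ p : α × α, G.IsLink e p.1 p.2 := ⟨(x, y), h⟩
  rw [incVec, dif_pos hex]
  obtain ⟨h1, h2⟩ | ⟨h1, h2⟩ := hex.choose_spec.eq_and_eq_or_eq_and_eq h
  · rw [h1, h2]
  · rw [h1, h2, add_comm]

lemma path_mem_span {x y : α} {U : Set α} {P : Set β} (h : G.IsPathBetween x y U P) :
    (Finsupp.single x 1 + Finsupp.single y 1 : α →₀ ZMod 2) ∈
      Submodule.span (ZMod 2) (incVec G '' P) := by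
  induction h with
  | nil x hx =>
    rw [← Finsupp.single_add, show (1 + 1 : ZMod 2) = 0 from rfl, Finsupp.single_zero]
    exact Submodule.zero_mem _
  | cons x y z e U P he hx h ih =>
    have h1 : incVec G e ∈ Submodule.span (ZMod 2) (incVec G '' insert e P) :=
      Submodule.subset_span ⟨e, mem_insert _ _, rfl⟩
    have h2 := Submodule.span_mono (R := ZMod 2)
      (image_mono (f := incVec G) (subset_insert e P)) ih
    have h3 := Submodule.add_mem _ h1 h2
    rw [incVec_eq he] at h3
    convert h3 using 1
    have hy : (Finsupp.single y 1 + Finsupp.single y 1 : α →₀ ZMod 2) = 0 := by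
      rw [← Finsupp.single_add, show (1 + 1 : ZMod 2) = 0 from rfl, Finsupp.single_zero]
    rw [add_assoc, ← add_assoc (Finsupp.single y 1), hy, zero_add]

lemma acyclic_iff {I : Set β} (hI : I ⊆ G.edgeSet) :
    (∀ C ⊆ I, ¬ G.IsCycleSet C) ↔ LinearIndepOn (ZMod 2) (incVec G) I := by
  classical
  rw [linearIndepOn_iff_notMem_span]
  constructor
  · intro hac f hf hmem
    obtain ⟨x, y, hxy⟩ := G.exists_isLink_of_mem_edgeSet (hI hf)
    rw [incVec_eq hxy] at hmem
    let S : Set α := {z | ∃ U P, P ⊆ I \ {f} ∧ G.IsPathBetween z y U P}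
    have hstep : ∀ e ∈ I \ {f}, ∀ z w, G.IsLink e z w → z ∈ S → w ∈ S := by
      rintro e he z w hzw ⟨U, P, hP, hp⟩
      by_cases hw : w ∈ U
      · obtain ⟨U₁, P₁, hP₁, h₁⟩ := hp.suffix hw
        exact ⟨U₁, P₁, hP₁.trans hP, h₁⟩
      · exact ⟨_, _, insert_subset he hP, .cons _ _ _ _ _ _ hzw.symm hw hp⟩
    have hyS : y ∈ S := ⟨_, _, empty_subset _, .nil y hxy.right_mem⟩
    let ψ : (α →₀ ZMod 2) →ₗ[ZMod 2] ZMod 2 :=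
      Finsupp.lsum (ZMod 2) (fun v => if v ∈ S then LinearMap.id else 0)
    have hψ : ∀ v, ψ (Finsupp.single v 1) = if v ∈ S then 1 else 0 := by
      intro v
      simp only [ψ, Finsupp.lsum_single]
      split_ifs <;> rfl
    have hker : Submodule.span (ZMod 2) (incVec G '' (I \ {f})) ≤ LinearMap.ker ψ := by
      rw [Submodule.span_le]
      rintro _ ⟨e, he, rfl⟩
      obtain ⟨z, w, hzw⟩ := G.exists_isLink_of_mem_edgeSet (hI he.1)
      rw [SetLike.mem_coe, LinearMap.mem_ker, incVec_eq hzw, map_add, hψ, hψ]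
      have : z ∈ S ↔ w ∈ S := ⟨hstep e he z w hzw, hstep e he w z hzw.symm⟩
      by_cases hz : z ∈ S
      · rw [if_pos hz, if_pos (this.1 hz)]; rfl
      · rw [if_neg hz, if_neg (fun h => hz (this.2 h))]; rfl
    have h0 := hker hmem
    rw [LinearMap.mem_ker, map_add, hψ, hψ, if_pos hyS] at h0
    have hxS : x ∈ S := by
      by_contra hx
      rw [if_neg hx] at h0
      exact absurd h0 (by decide)
    obtain ⟨U, P, hP, hp⟩ := hxS
    exact hac (insert f P) (insert_subset hf (hP.trans sdiff_subset))
      ⟨x, y, U, P, f, hp, hxy, fun h => (hP h).2 rfl, rfl⟩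
  · rintro hli _ hC ⟨x, y, U, P, f, hp, hf, hfP, rfl⟩
    refine hli f (hC (mem_insert _ _)) ?_
    rw [incVec_eq hf]
    refine Submodule.span_mono (image_mono fun e he => ?_) (path_mem_span hp)
    exact ⟨hC (mem_insert_of_mem _ he), fun h => hfP (h ▸ he)⟩

/-- The cycle matroid `M(G)` of a graph `G` with finitely many edges: its ground set is the edge
set of `G`, and a set of edges is independent if it contains no cycle. -/
noncomputable def cycleMatroid (G : Graph α β) (hE : G.edgeSet.Finite) : Matroid β :=
  (IndepMatroid.ofFinite hE (fun I => I ⊆ G.edgeSet ∧ ∀ C ⊆ I, ¬ G.IsCycleSet C)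
    ⟨empty_subset _, by
      rintro C hC ⟨x, y, U, P, f, -, -, -, rfl⟩
      exact hC (mem_insert _ _)⟩
    (fun I J hJ hIJ => ⟨hIJ.trans hJ.1, fun C hC => hJ.2 C (hC.trans hIJ)⟩)
    (by
      rintro I J ⟨hI, hIc⟩ ⟨hJ, hJc⟩ hlt
      rw [acyclic_iff hI] at hIc
      rw [acyclic_iff hJ] at hJc
      have key : ∃ e ∈ J, incVec G e ∉ Submodule.span (ZMod 2) (incVec G '' I) := by
        by_contra! hcon
        have hIfin := hE.subset hI
        have hle : Submodule.span (ZMod 2) (incVec G '' J) ≤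
            Submodule.span (ZMod 2) (incVec G '' I) := by
          rw [Submodule.span_le]
          rintro _ ⟨e, he, rfl⟩
          exact hcon e he
        have hJ1 : Set.ncard (incVec G '' J) = J.ncard := hJc.injOn.ncard_image
        have hI1 : Set.ncard (incVec G '' I) ≤ I.ncard := ncard_image_le hIfin
        have hJfin := (hE.subset hJ).image (incVec G)
        have hIfin2 := hIfin.image (incVec G)
        have := hJfin.fintype
        have := hIfin2.fintype
        have : FiniteDimensional (ZMod 2) (Submodule.span (ZMod 2) (incVec G '' I)) :=
          FiniteDimensional.span_of_finite _ hIfin2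
        have h1 := Submodule.finrank_mono hle
        have h2 : Module.finrank (ZMod 2) (Submodule.span (ZMod 2) (incVec G '' J)) =
            (incVec G '' J).toFinset.card :=
          finrank_span_set_eq_card hJc.id_image
        have h3 := finrank_span_le_card (R := ZMod 2) (incVec G '' I)
        rw [h2, ← ncard_eq_toFinset_card'] at h1
        rw [← ncard_eq_toFinset_card'] at h3
        omega
      obtain ⟨e, heJ, he⟩ := key
      refine ⟨e, heJ, fun heI => he (Submodule.subset_span ⟨e, heI, rfl⟩),
        insert_subset (hJ heJ) hI, ?_⟩
      rw [acyclic_iff (insert_subset (hJ heJ) hI)]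
      exact hIc.insert he)
    (fun I hI => hI.1)).matroid

end CycleMatroid

end Graph

/-- A (finite) biased graph: a finite multigraph (loops and parallel edges allowed) together with
a collection of balanced cycles, identified with their edge sets, such that no theta subgraph
contains exactly two balanced cycles. -/
structure BiasedGraph (α β : Type*) where
  graph : Graph α β
  vertexSet_finite : graph.vertexSet.Finite
  edgeSet_finite : graph.edgeSet.Finite
  balanced : Set (Set β)
  isCycleSet_of_balanced : ∀ C ∈ balanced, graph.IsCycleSet C
  theta_property : ∀ P₁ P₂ P₃, graph.IsTheta P₁ P₂ P₃ →
    P₁ ∪ P₂ ∈ balanced → P₁ ∪ P₃ ∈ balanced → P₂ ∪ P₃ ∈ balanced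

namespace BiasedGraph

variable {α β : Type*}

/-- `C` is an unbalanced cycle. -/
def IsUnbalancedCycle (Ω : BiasedGraph α β) (C : Set β) : Prop :=
  Ω.graph.IsCycleSet C ∧ C ∉ Ω.balanced

/-- `e` is an unbalanced loop. -/
def IsUnbalancedLoop (Ω : BiasedGraph α β) (e : β) : Prop :=
  (∃ x, Ω.graph.IsLoopAt e x) ∧ {e} ∉ Ω.balanced

/-- Two edge-disjoint unbalanced cycles meeting in exactly one vertex. -/
def IsTightHandcuff (Ω : BiasedGraph α β) (C : Set β) : Prop :=
  ∃ C₁ C₂, Ω.IsUnbalancedCycle C₁ ∧ Ω.IsUnbalancedCycle C₂ ∧ Disjoint C₁ C₂ ∧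
    (∃ v, Ω.graph.verts C₁ ∩ Ω.graph.verts C₂ = {v}) ∧ C = C₁ ∪ C₂

/-- Two vertex-disjoint unbalanced cycles together with a path connecting them, which meets each
of the two cycles only in one of its ends. -/
def IsLooseHandcuff (Ω : BiasedGraph α β) (C : Set β) : Prop :=
  ∃ C₁ C₂ x y U P, Ω.IsUnbalancedCycle C₁ ∧ Ω.IsUnbalancedCycle C₂ ∧
    Disjoint (Ω.graph.verts C₁) (Ω.graph.verts C₂) ∧ Ω.graph.IsPathBetween x y U P ∧
    U ∩ Ω.graph.verts C₁ = {x} ∧ U ∩ Ω.graph.verts C₂ = {y} ∧ C = C₁ ∪ C₂ ∪ P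

/-- A theta subgraph all three of whose cycles are unbalanced. -/
def IsContrabalancedTheta (Ω : BiasedGraph α β) (C : Set β) : Prop :=
  ∃ P₁ P₂ P₃, Ω.graph.IsTheta P₁ P₂ P₃ ∧ P₁ ∪ P₂ ∉ Ω.balanced ∧ P₁ ∪ P₃ ∉ Ω.balanced ∧
    P₂ ∪ P₃ ∉ Ω.balanced ∧ C = P₁ ∪ P₂ ∪ P₃

/-- The edge sets that are circuits of the frame matroid `F(Ω)`. -/
def IsFrameCircuit (Ω : BiasedGraph α β) (C : Set β) : Prop :=
  C ∈ Ω.balanced ∨ Ω.IsTightHandcuff C ∨ Ω.IsLooseHandcuff C ∨ Ω.IsContrabalancedTheta C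

/-- `M = F(Ω)`: the ground set of `M` is the edge set of `Ω`, and the circuits of `M` are exactly
the edge sets in `IsFrameCircuit` (these data determine `M`). -/
def Represents (Ω : BiasedGraph α β) (M : Matroid β) : Prop :=
  M.E = Ω.graph.edgeSet ∧ ∀ C, M.IsCircuit C ↔ Ω.IsFrameCircuit C

end BiasedGraph

/-- A matroidal: a matroid together with a distinguished set of its elements. -/
structure Matroidal (β : Type*) where
  M : Matroid β
  L : Set β
  subset_ground : L ⊆ M.E

namespace Matroidal

variable {β : Type*}

/-- `(M, L)` is frame if `M = F(Ω)` for some biased graph `Ω` in which every element of `L` is an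
unbalanced loop. As biased graphs are finite, vertices from a type in the lowest universe
suffice. -/
def IsFrame (A : Matroidal β) : Prop :=
  ∃ (V : Type) (Ω : BiasedGraph V β), Ω.Represents A.M ∧ ∀ e ∈ A.L, Ω.IsUnbalancedLoop e

/-- `B` arises from `A` by one of the three operations: deleting an element not in `L`, contracting
an element not in `L`, removing an element from `L`. -/
inductive Step (A B : Matroidal β) : Prop
  | delete (e : β) (heE : e ∈ A.M.E) (heL : e ∉ A.L) (hM : B.M = A.M.delete {e}) (hL : B.L = A.L)
  | contract (e : β) (heE : e ∈ A.M.E) (heL : e ∉ A.L) (hM : B.M = A.M.contract {e})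
      (hL : B.L = A.L)
  | remove (e : β) (heL : e ∈ A.L) (hM : B.M = A.M) (hL : B.L = A.L \ {e})

/-- `B` is a minor of `A`. -/
def IsMinor (B A : Matroidal β) : Prop := Relation.ReflTransGen Step A B

/-- No distinguished element is a loop of the matroid. A frame matroidal always has this property,
because an unbalanced loop of `Ω` is not a loop of `F(Ω)`. -/
def LoopFree (A : Matroidal β) : Prop := ∀ e ∈ A.L, ¬ A.M.IsLoop e

/-- `A` is an excluded minor for the class of frame matroidals, among matroidals whose distinguished
elements are not loops. (Contracting an element parallel to a member of `L` turns the latter into a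
loop; without excluding this, the class of frame matroidals is not closed under minors.) -/
def IsExcludedMinor (A : Matroidal β) : Prop :=
  A.LoopFree ∧ ¬ A.IsFrame ∧ ∀ B : Matroidal β, B.IsMinor A → B ≠ A → B.LoopFree → B.IsFrame

end Matroidal

/-- The wheel `W₄`: the hub is `none`, the rim vertices are `some 0, …, some 3`; the edge `inl i` is
the rim edge joining `i` and `i + 1` (modulo 4), the edge `inr i` is the spoke joining the hub
and `i`. -/
def wheelFour : Graph (Option (Fin 4)) (Fin 4 ⊕ Fin 4) where
  vertexSet := univ
  edgeSet := univ
  IsLink e x y := match e with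
    | .inl i => s(x, y) = s(some i, some (i + 1))
    | .inr i => s(x, y) = s(none, some i)
  isLink_symm := by
    rintro (i | i) - <;> exact ⟨fun x y h => by rw [Sym2.eq_swap]; exact h⟩
  eq_or_eq_of_isLink_of_isLink := by
    rintro (i | i) x y v w h1 h2 <;>
    · have h := Sym2.eq_iff.1 (h1.trans h2.symm)
      tauto
  edge_mem_iff_exists_isLink := by
    rintro (i | i)
    · exact ⟨fun _ => ⟨_, _, rfl⟩, fun _ => mem_univ _⟩
    · exact ⟨fun _ => ⟨_, _, rfl⟩, fun _ => mem_univ _⟩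
  left_mem_of_isLink := fun _ _ _ _ => mem_univ _

/-- The matroidal `(M(W₄), {e₁, e₂})`, with `e₁`, `e₂` the opposite rim edges `01` and `23`. -/
noncomputable def matroidalEight : Matroidal (Fin 4 ⊕ Fin 4) where
  M := wheelFour.cycleMatroid (toFinite _)
  L := {.inl 0, .inl 2}
  subset_ground := subset_univ _

/-! Positive half. Suppose a matroid is graphic and some vertex of the graph, the root, is an end of
every distinguished edge (`IsStarGraphic`). Delete the root and keep its edges as unbalanced loops
at their other ends. A cycle through the root turns into two such loops joined by a possibly trivial
path, which is a handcuff, and all other cycles stay balanced, so the frame matroid is the original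
matroid (`Matroid.IsBinaryRep.represents`). A distinguished edge becomes an unbalanced loop unless
it was a loop already (`IsStarGraphic.isFrame`).

Having such a root passes to minors (`IsStarGraphic.isMinor`), so it suffices to find one after a
single step from `matroidalEight` (`isStarGraphic_of_step`). Two opposite rim edges of the wheel
share no vertex, but after a deletion or a contraction they do, or can be made to do so by
interchanging edges in series or by a Whitney twist, neither of which changes the matroid. If a
distinguished element is released, an end of the other one is a root.

Negative half (`not_isFrame_matroidalEight`). If `inl 0` and `inl 2` are loops at `x` and `y`, the
rim and the 5-cycle on `inl 0, inl 1, inl 2, inr 3, inr 0` make {`inl 1`, `inl 3`} and {`inl 1`,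
`inr 0`, `inr 3`} paths from `x` to `y`. The triangles on the two loops put `inr 0` at `x` and `inr
3` at `y`. The first path puts `inl 1` at `x` or at `y`, so the second path has two edges at one of
its ends, a contradiction.

Graphic matroids are handled through mod-2 incidence vectors, which reduces statements about the
wheel to finite checks. -/

namespace Graph

variable {α β : Type*} {G : Graph α β}

/-! ### Paths and cycles in multigraphs -/

namespace IsPathBetween

lemma left_mem {x y : α} {U : Set α} {P : Set β} (h : G.IsPathBetween x y U P) : x ∈ U := by
  cases h <;> simp

lemma right_mem {x y : α} {U : Set α} {P : Set β} (h : G.IsPathBetween x y U P) : y ∈ U := by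
  induction h with
  | nil => simp
  | cons x y z e U P he hx h ih => exact mem_insert_of_mem _ ih

lemma mem_of_isLink {x y : α} {U : Set α} {P : Set β} (h : G.IsPathBetween x y U P)
    {e : β} (he : e ∈ P) {z w : α} (hzw : G.IsLink e z w) : z ∈ U ∧ w ∈ U := by
  induction h with
  | nil => simp at he
  | cons x y z' e' U P he' hx h ih =>
    rcases he with rfl | he
    · rcases hzw.eq_and_eq_or_eq_and_eq he' with ⟨rfl, rfl⟩ | ⟨rfl, rfl⟩
      · exact ⟨mem_insert _ _, mem_insert_of_mem _ h.left_mem⟩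
      · exact ⟨mem_insert_of_mem _ h.left_mem, mem_insert _ _⟩
    · exact ⟨mem_insert_of_mem _ (ih he).1, mem_insert_of_mem _ (ih he).2⟩

lemma notMem_of_isLink {x y z w : α} {U : Set α} {P : Set β} (h : G.IsPathBetween x y U P)
    {e : β} (hzw : G.IsLink e z w) (hz : z ∉ U) : e ∉ P :=
  fun he => hz (h.mem_of_isLink he hzw).1

lemma ne_of_isLink {x y : α} {U : Set α} {P : Set β} (h : G.IsPathBetween x y U P)
    {e : β} (he : e ∈ P) {z w : α} (hzw : G.IsLink e z w) : z ≠ w := by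
  induction h with
  | nil => simp at he
  | cons x y z' e' U P he' hx h ih =>
    rcases he with rfl | he
    · have hxy : x ≠ y := fun h' => hx (h' ▸ h.left_mem)
      rcases hzw.eq_and_eq_or_eq_and_eq he' with ⟨rfl, rfl⟩ | ⟨rfl, rfl⟩
      · exact hxy
      · exact hxy.symm
    · exact ih he

lemma mem_edgeSet {x y : α} {U : Set α} {P : Set β} (h : G.IsPathBetween x y U P)
    {e : β} (he : e ∈ P) : e ∈ G.edgeSet := by
  induction h with
  | nil => simp at he
  | cons x y z' e' U P he' hx h ih =>
    rcases he with rfl | he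
    · exact he'.edge_mem
    · exact ih he

lemma eq_empty {x : α} {U : Set α} {P : Set β} (h : G.IsPathBetween x x U P) : P = ∅ := by
  cases h with
  | nil => rfl
  | cons _ y _ e U P he hx h => exact absurd h.right_mem hx

lemma eq_of_empty {x y : α} {U : Set α} (h : G.IsPathBetween x y U ∅) : x = y := by
  generalize hP : (∅ : Set β) = P at h
  cases h with
  | nil => rfl
  | cons _ y _ e U P he hx h => exact absurd hP.symm (insert_nonempty _ _).ne_empty

lemma isLink_of_singleton {x y : α} {U : Set α} {e : β} (h : G.IsPathBetween x y U {e}) :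
    G.IsLink e x y := by
  generalize hP : ({e} : Set β) = P at h
  cases h with
  | nil => simp at hP
  | cons _ w _ f U P he hx h =>
    obtain rfl : f = e := by
      have : f ∈ ({e} : Set β) := hP ▸ mem_insert _ _
      exact this
    obtain rfl : P = ∅ := by
      refine eq_empty_of_forall_notMem fun g hg => ?_
      obtain rfl : g = f := by
        have : g ∈ ({f} : Set β) := hP ▸ mem_insert_of_mem _ hg
        exact this
      exact h.notMem_of_isLink he hx hg
    rwa [h.eq_of_empty] at he

/-- A path has at most one edge at its first vertex. -/
lemma eq_of_inc_left {x y : α} {U : Set α} {P : Set β} (h : G.IsPathBetween x y U P)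
    {e f : β} (he : e ∈ P) (hf : f ∈ P) (hex : G.Inc e x) (hfx : G.Inc f x) : e = f := by
  cases h with
  | nil => simp at he
  | cons _ w _ g U P hg hx h =>
    have key : ∀ a ∈ insert g P, G.Inc a x → a = g := by
      rintro a (rfl | ha) ⟨b, hb⟩
      · rfl
      · exact absurd ha (h.notMem_of_isLink hb hx)
    rw [key e he hex, key f hf hfx]

/-- A path has at most one edge at its last vertex. -/
lemma eq_of_inc_right {x y : α} {U : Set α} {P : Set β} (h : G.IsPathBetween x y U P)
    {e f : β} (he : e ∈ P) (hf : f ∈ P) (hey : G.Inc e y) (hfy : G.Inc f y) : e = f := by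
  induction h with
  | nil => simp at he
  | cons x w y g U P hg hx h ih =>
    -- If the first edge already reaches the last vertex, the remaining path runs from that vertex
    -- to itself.
    have key : G.Inc g y → P = ∅ := by
      rintro ⟨b, hb⟩
      rcases hb.eq_and_eq_or_eq_and_eq hg with ⟨rfl, rfl⟩ | ⟨rfl, rfl⟩
      · exact absurd h.right_mem hx
      · exact h.eq_empty
    rcases he with rfl | he <;> rcases hf with rfl | hf
    · rfl
    · rw [key hey] at hf
      exact hf.elim
    · rw [key hfy] at he
      exact he.elim
    · exact ih he hf hey hfy

lemma append {x y z : α} {U U' : Set α} {P P' : Set β} (h : G.IsPathBetween x y U P)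
    (h' : G.IsPathBetween y z U' P') (hU : U ∩ U' ⊆ {y}) :
    G.IsPathBetween x z (U ∪ U') (P ∪ P') := by
  induction h with
  | nil x hx =>
    rw [singleton_union, insert_eq_of_mem h'.left_mem, empty_union]
    exact h'
  | cons x w y e U P he hx h ih =>
    rw [insert_union, insert_union]
    refine .cons _ _ _ _ _ _ he ?_
      (ih h' fun v hv => hU ⟨mem_insert_of_mem _ hv.1, hv.2⟩)
    rintro (hxU | hxU')
    · exact hx hxU
    · obtain rfl : x = y := hU ⟨mem_insert _ _, hxU'⟩
      exact hx h.right_mem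

lemma reverse {x y : α} {U : Set α} {P : Set β} (h : G.IsPathBetween x y U P) :
    G.IsPathBetween y x U P := by
  induction h with
  | nil x hx => exact .nil x hx
  | cons x w y e U P he hx h ih =>
    have h1 : G.IsPathBetween w x {w, x} {e} := by
      have := IsPathBetween.cons w x x e {x} ∅ he.symm
        (fun hw => hx (by rw [← mem_singleton_iff.1 hw]; exact h.left_mem)) (.nil x he.left_mem)
      rwa [insert_empty_eq] at this
    have h2 := ih.append h1 (by
      rintro v ⟨hv, rfl | rfl⟩
      · rfl
      · exact absurd hv hx)
    convert h2 using 1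
    · ext v
      simp only [mem_insert_iff, mem_union, mem_singleton_iff]
      have := h.left_mem
      constructor
      · tauto
      · rintro (hv | rfl | rfl) <;> tauto
    · rw [union_singleton]

end IsPathBetween

lemma isCycleSet_of_isLoopAt {e : β} {x : α} (h : G.IsLink e x x) : G.IsCycleSet {e} :=
  ⟨x, x, {x}, ∅, e, .nil x h.left_mem, h, notMem_empty _, by simp⟩

lemma IsCycleSet.eq_singleton {C : Set β} (hC : G.IsCycleSet C) {e : β} (he : e ∈ C) {x : α}
    (hx : G.IsLink e x x) : C = {e} := by
  obtain ⟨u, v, U, P, f, hP, hf, -, rfl⟩ := hC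
  rcases he with rfl | he
  · obtain rfl : u = v := by
      rcases hf.eq_and_eq_or_eq_and_eq hx with ⟨rfl, rfl⟩ | ⟨rfl, rfl⟩ <;> rfl
    rw [hP.eq_empty, insert_empty_eq]
  · exact absurd rfl (hP.ne_of_isLink he hx)

lemma IsCycleSet.exists_isLoopAt {e : β} (hC : G.IsCycleSet {e}) : ∃ x, G.IsLink e x x := by
  obtain ⟨u, v, U, P, f, hP, hf, hfP, h⟩ := hC
  obtain rfl : f = e := by
    have : f ∈ ({e} : Set β) := h ▸ mem_insert _ _
    exact this
  obtain rfl : P = ∅ := eq_empty_of_forall_notMem fun g hg => by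
    have : g ∈ ({f} : Set β) := h ▸ mem_insert_of_mem _ hg
    rw [mem_singleton_iff.1 this] at hg
    exact hfP hg
  exact ⟨u, by rwa [← hP.eq_of_empty] at hf⟩

/-- The two edges of a cycle of length two have the same ends. -/
lemma IsCycleSet.exists_isLink_pair {e f : β} (hef : e ≠ f) (hC : G.IsCycleSet {e, f}) :
    ∃ x y, G.IsLink e x y ∧ G.IsLink f x y := by
  obtain ⟨u, v, U, P, g, hP, hg, hgP, h⟩ := hC
  have hPe : P = {e, f} \ {g} := by
    rw [h, insert_sdiff_of_mem _ (mem_singleton _), sdiff_singleton_eq_self hgP]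
  have hge : g ∈ ({e, f} : Set β) := h ▸ mem_insert _ _
  rcases hge with rfl | rfl
  · obtain rfl : P = {f} := by rw [hPe]; ext a; simp; rintro rfl; exact hef.symm
    exact ⟨u, v, hg, hP.isLink_of_singleton⟩
  · obtain rfl : P = {e} := by rw [hPe]; ext a; simp; grind
    exact ⟨u, v, hP.isLink_of_singleton, hg⟩

/-- Two internally disjoint paths with the same pair of distinct ends form a cycle. -/
lemma IsPathBetween.isCycleSet_union {x y : α} {U U' : Set α} {P P' : Set β} (hxy : x ≠ y)
    (h : G.IsPathBetween x y U P) (h' : G.IsPathBetween x y U' P') (hU : U ∩ U' = {x, y})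
    (hP : Disjoint P P') : G.IsCycleSet (P ∪ P') := by
  cases h with
  | nil => exact absurd rfl hxy
  | cons _ w _ e U P he hx h =>
    refine ⟨w, x, U ∪ U', P ∪ P', e, h.append h'.reverse ?_, he.symm, ?_, insert_union⟩
    · rintro v ⟨hv, hv'⟩
      have : v ∈ ({x, y} : Set α) := hU ▸ ⟨mem_insert_of_mem _ hv, hv'⟩
      rcases this with rfl | rfl
      · exact absurd hv hx
      · rfl
    · rintro (heP | heP')
      · exact h.notMem_of_isLink he hx heP
      · exact disjoint_left.1 hP (mem_insert _ _) heP'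

lemma IsTheta.isCycleSet {P₁ P₂ P₃ : Set β} (h : G.IsTheta P₁ P₂ P₃) :
    G.IsCycleSet (P₁ ∪ P₂) ∧ G.IsCycleSet (P₁ ∪ P₃) ∧ G.IsCycleSet (P₂ ∪ P₃) := by
  obtain ⟨x, y, U₁, U₂, U₃, hxy, h₁, h₂, h₃, h₁₂, h₁₃, h₂₃, d₁₂, d₁₃, d₂₃⟩ := h
  exact ⟨h₁.isCycleSet_union hxy h₂ h₁₂ d₁₂, h₁.isCycleSet_union hxy h₃ h₁₃ d₁₃,
    h₂.isCycleSet_union hxy h₃ h₂₃ d₂₃⟩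

lemma IsTheta.ne_of_isLink {P₁ P₂ P₃ : Set β} (h : G.IsTheta P₁ P₂ P₃) {e : β}
    (he : e ∈ P₁ ∪ P₂ ∪ P₃) {z w : α} (hzw : G.IsLink e z w) : z ≠ w := by
  obtain ⟨x, y, U₁, U₂, U₃, hxy, h₁, h₂, h₃, -⟩ := h
  rcases he with (he | he) | he
  · exact h₁.ne_of_isLink he hzw
  · exact h₂.ne_of_isLink he hzw
  · exact h₃.ne_of_isLink he hzw

lemma verts_singleton_of_isLoopAt {e : β} {x : α} (h : G.IsLink e x x) : G.verts {e} = {x} := by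
  ext v
  constructor
  · rintro ⟨_, rfl, w, hw⟩
    rcases hw.eq_and_eq_or_eq_and_eq h with ⟨rfl, rfl⟩ | ⟨rfl, rfl⟩ <;> rfl
  · rintro rfl
    exact ⟨e, rfl, v, h⟩

end Graph

/-! ### Binary representations by zero sums -/

namespace Matroid

variable {β N N' : Type*} [AddCommGroup N] [AddCommGroup N'] {M : Matroid β} {v : β → N}

/-- `M` is represented over the two-element field by the vectors `v e`: a set is independent if no
nonempty finite subset sums to zero. -/
def IsBinaryRep (M : Matroid β) (v : β → N) : Prop :=
  ∀ I, M.Indep I ↔ I ⊆ M.E ∧ ∀ S : Finset β, ↑S ⊆ I → ∑ e ∈ S, v e = 0 → S = ∅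

lemma linearIndepOn_zmod_two_iff [Module (ZMod 2) N] {I : Set β} :
    LinearIndepOn (ZMod 2) v I ↔ ∀ S : Finset β, ↑S ⊆ I → ∑ e ∈ S, v e = 0 → S = ∅ := by
  classical
  rw [linearIndepOn_iff']
  constructor
  · intro h S hS h0
    refine Finset.eq_empty_of_forall_notMem fun e he => ?_
    have := h S (fun _ => 1) hS (by simpa using h0) e he
    exact absurd this (by decide)
  · intro h S g hS h0 e he
    by_contra hne
    have h1 : ∑ i ∈ S with g i ≠ 0, v i = 0 := by
      rw [← h0, Finset.sum_filter]
      refine Finset.sum_congr rfl fun i _ => ?_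
      have : g i = 0 ∨ g i = 1 := by
        generalize g i = a
        revert a
        decide
      rcases this with hi | hi <;> simp [hi]
    have h2 := h _ (fun i hi => hS (Finset.mem_of_mem_filter i hi)) h1
    exact Finset.notMem_empty e (h2 ▸ Finset.mem_filter.2 ⟨he, hne⟩)

namespace IsBinaryRep

/-- Only the family of zero-sum sets matters, so a graph may be replaced by any other with the same
zero sums, such as a Whitney twist of it. -/
lemma congr (h : M.IsBinaryRep v) {w : β → N'}
    (hw : ∀ S : Finset β, ↑S ⊆ M.E → (∑ e ∈ S, w e = 0 ↔ ∑ e ∈ S, v e = 0)) :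
    M.IsBinaryRep w := by
  intro I
  rw [h I]
  refine and_congr_right fun hI => forall_congr' fun S => forall_congr' fun hS => ?_
  rw [hw S (hS.trans hI)]

lemma delete (h : M.IsBinaryRep v) (D : Set β) : (M.delete D).IsBinaryRep v := by
  intro I
  rw [delete_indep_iff, h I, delete_ground, subset_sdiff]
  tauto

lemma isLoop_iff (h : M.IsBinaryRep v) {e : β} (he : e ∈ M.E) : M.IsLoop e ↔ v e = 0 := by
  rw [← singleton_dep, ← not_indep_iff, h {e}]
  constructor
  · intro h1
    by_contra h2
    refine h1 ⟨by simpa using he, fun S hS h0 => ?_⟩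
    rcases Finset.subset_singleton_iff.1 (show S ⊆ {e} by exact_mod_cast hS) with rfl | rfl
    · rfl
    · simp [h2] at h0
  · rintro h1 ⟨-, h2⟩
    have := h2 {e} (by simp) (by simpa using h1)
    simp at this

lemma contract_of_eq_zero (h : M.IsBinaryRep v) {e : β} (he : e ∈ M.E) (hv : v e = 0) :
    (M.contract {e}).IsBinaryRep v := by
  rw [contract_eq_delete_of_subset_loops (singleton_subset_iff.2 ((h.isLoop_iff he).2 hv))]
  exact h.delete _

/-- Contraction is projection from `v e`. Modulo two the span of `v e` is {0, `v e`}, so `hw` says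
that `w` has the zero sums of the quotient by this span. -/
lemma contract [Module (ZMod 2) N] (h : M.IsBinaryRep v) {e : β} (he : e ∈ M.E) (hv : v e ≠ 0) {w : β → N'}
    (hw : ∀ S : Finset β, e ∉ S → (∑ f ∈ S, w f = 0 ↔ ∑ f ∈ S, v f = 0 ∨ ∑ f ∈ S, v f = v e)) :
    (M.contract {e}).IsBinaryRep w := by
  classical
  have hnl : M.IsNonloop e := by
    rw [← not_isLoop_iff, h.isLoop_iff he]
    exact hv
  intro I
  rw [hnl.contractElem_indep_iff, h, contract_ground, subset_sdiff, disjoint_singleton_right]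
  constructor
  · rintro ⟨heI, hI, hS⟩
    refine ⟨⟨(subset_insert _ _).trans hI, heI⟩, fun S hSI h0 => ?_⟩
    have heS : e ∉ S := fun h' => heI (hSI h')
    rcases (hw S heS).1 h0 with h1 | h1
    · exact hS S (hSI.trans (subset_insert _ _)) h1
    · have := hS (insert e S) (by rw [Finset.coe_insert]; exact insert_subset_insert hSI)
        (by rw [Finset.sum_insert heS, h1, ZModModule.add_self])
      exact absurd this (Finset.insert_ne_empty _ _)
  · rintro ⟨⟨hI, heI⟩, hS⟩
    refine ⟨heI, insert_subset he hI, fun S hSI h0 => ?_⟩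
    by_cases heS : e ∈ S
    · have h1 : S.erase e = ∅ := by
        refine hS _ ?_ ((hw _ (Finset.notMem_erase _ _)).2 (Or.inr ?_))
        · rw [Finset.coe_erase]
          exact sdiff_singleton_subset_iff.2 hSI
        · rw [← Finset.add_sum_erase _ _ heS] at h0
          rw [← ZModModule.neg_eq_self (∑ f ∈ S.erase e, v f)]
          exact (eq_neg_of_add_eq_zero_left h0).symm
      rw [← Finset.add_sum_erase _ _ heS, h1, Finset.sum_empty, add_zero] at h0
      exact absurd h0 hv
    · refine hS S (fun f hf => ?_) ((hw S heS).2 (Or.inl h0))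
      exact (hSI hf).resolve_left fun hfe => heS (hfe ▸ hf)

lemma exists_of_isCircuit (h : M.IsBinaryRep v) {C : Set β} (hC : M.IsCircuit C) :
    ∃ S : Finset β, ↑S = C ∧ S.Nonempty ∧ ∑ e ∈ S, v e = 0 := by
  have h1 := hC.not_indep
  rw [h C] at h1
  push Not at h1
  obtain ⟨S, hSC, h0, hne⟩ := h1 hC.subset_ground
  refine ⟨S, ?_, hne, h0⟩
  by_contra hcon
  have h2 := hC.ssubset_indep (hSC.ssubset_of_ne hcon)
  exact hne.ne_empty (((h _).1 h2).2 S Subset.rfl h0)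

/-- Complements in `S` of zero-sum subsets are zero-sum, and one of the two misses `f`. Hence
minimality needs testing only on subsets without `f`. -/
lemma isCircuit (h : M.IsBinaryRep v) {S : Finset β} {f : β} (hSE : ↑S ⊆ M.E) (hf : f ∈ S)
    (h0 : ∑ e ∈ S, v e = 0) (hmin : ∀ T ⊆ S, f ∉ T → ∑ e ∈ T, v e = 0 → T = ∅) :
    M.IsCircuit (S : Set β) := by
  classical
  rw [isCircuit_iff_dep_forall_sdiff_singleton_indep, ← not_indep_iff hSE]
  refine ⟨fun hS => ?_, fun e he => ?_⟩
  · rw [((h _).1 hS).2 S Subset.rfl h0] at hf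
    exact Finset.notMem_empty _ hf
  · rw [h]
    refine ⟨sdiff_subset.trans hSE, fun T hT hT0 => ?_⟩
    have hTS : T ⊆ S := fun x hx => (hT hx).1
    have heT : e ∉ T := fun hx => (hT hx).2 rfl
    by_cases hfT : f ∈ T
    · have h1 : S \ T = ∅ := by
        refine hmin _ Finset.sdiff_subset (fun h' => (Finset.mem_sdiff.1 h').2 hfT) ?_
        rw [← Finset.sum_sdiff hTS, hT0, add_zero] at h0
        exact h0
      exact absurd (Finset.sdiff_eq_empty_iff_subset.1 h1 he) heT
    · exact hmin T hTS hfT hT0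

end IsBinaryRep

end Matroid

/-! ### Incidence vectors without the coordinate of the root -/

section RootedVec

variable {V β : Type*} [DecidableEq V]

/-- The unit vector of a vertex; the root `none` gives the zero vector. -/
def rootedVec (a : Option V) : V → ZMod 2 := fun x => if a = some x then 1 else 0

@[simp] lemma rootedVec_none : rootedVec (none : Option V) = 0 := by
  ext x
  simp [rootedVec]

lemma rootedVec_eq_zero {a : Option V} : rootedVec a = 0 ↔ a = none := by
  constructor
  · intro h
    cases a with
    | none => rfl
    | some x => simpa [rootedVec] using congrFun h x
  · rintro rfl
    exact rootedVec_none

lemma rootedVec_injective : Function.Injective (rootedVec (V := V)) := by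
  intro a b hab
  cases a with
  | none => exact (rootedVec_eq_zero.1 (hab.symm.trans rootedVec_none)).symm
  | some x =>
    have := congrFun hab x
    simp only [rootedVec, if_true] at this
    by_contra hne
    rw [if_neg (fun h => hne h.symm)] at this
    exact one_ne_zero this

/-- The linear map induced by moving the vertex `y` to `a`. -/
def moveVertex (y : V) (a : Option V) : (V → ZMod 2) →ₗ[ZMod 2] (V → ZMod 2) where
  toFun w := fun z => (if z = y then 0 else w z) + w y * rootedVec a z
  map_add' w w' := by
    ext z
    simp only [Pi.add_apply]
    split_ifs <;> ring
  map_smul' c w := by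
    ext z
    simp only [Pi.smul_apply, smul_eq_mul, RingHom.id_apply]
    split_ifs <;> ring

lemma moveVertex_rootedVec (y : V) (a b : Option V) :
    moveVertex y a (rootedVec b) = rootedVec (if b = some y then a else b) := by
  ext z
  simp only [moveVertex, LinearMap.coe_mk, AddHom.coe_mk]
  by_cases hb : b = some y
  · subst hb
    by_cases hz : z = y
    · subst hz
      simp [rootedVec]
    · have : y ≠ z := fun h => hz h.symm
      simp [rootedVec, hz, this]
  · by_cases hz : z = y
    · subst hz
      simp [rootedVec, hb]
    · simp [rootedVec, hz, hb]

/-- The kernel is spanned by the vector of an edge from `a` to `y`; identifying the two ends of an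
edge is therefore projection from its vector. -/
lemma moveVertex_eq_zero {y : V} {a : Option V} {w : V → ZMod 2} (ha : a ≠ some y) :
    moveVertex y a w = 0 ↔ w = 0 ∨ w = rootedVec a + rootedVec (some y) := by
  constructor
  · intro h
    have h1 : w = w y • (rootedVec a + rootedVec (some y)) := by
      ext z
      have hz := congrFun h z
      simp only [moveVertex, LinearMap.coe_mk, AddHom.coe_mk, Pi.zero_apply] at hz
      simp only [Pi.smul_apply, Pi.add_apply, smul_eq_mul]
      by_cases hzy : z = y
      · subst hzy
        simp [rootedVec, ha]
      · rw [if_neg hzy] at hz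
        have : rootedVec (some y) z = 0 := by simp [rootedVec, Ne.symm hzy]
        rw [this, add_zero, ← CharTwo.add_eq_zero]
        exact hz
    have : w y = 0 ∨ w y = 1 := by
      generalize w y = c
      revert c
      decide
    rcases this with hw | hw
    · left
      rw [h1, hw, zero_smul]
    · right
      rw [h1, hw, one_smul]
  · rintro (rfl | rfl)
    · exact map_zero _
    · rw [map_add, moveVertex_rootedVec, moveVertex_rootedVec, if_pos rfl, if_neg ha,
        ZModModule.add_self]

/-- The vector of an edge with ends `p` and `q`. -/
def edgeVec (p q : β → Option V) (e : β) : V → ZMod 2 := rootedVec (p e) + rootedVec (q e)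

lemma edgeVec_eq_zero {p q : β → Option V} {e : β} : edgeVec p q e = 0 ↔ p e = q e := by
  rw [edgeVec, ← ZModModule.sub_eq_add, sub_eq_zero, rootedVec_injective.eq_iff]

end RootedVec

/-! ### Graphic matroids with a root meeting all distinguished elements -/

namespace Matroidal

variable {β : Type*}

/-- The matroid of `A` is graphic, represented by a graph with a root `none` that meets every
distinguished element. -/
def IsStarGraphic (A : Matroidal β) : Prop :=
  ∃ (V : Type) (_ : Finite V) (_ : DecidableEq V) (p q : β → Option V),
    A.M.IsBinaryRep (edgeVec p q) ∧ ∀ e ∈ A.L, p e = none ∨ q e = none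

/-- Contracting a non-loop identifies its ends. The end that is moved is never the root, so edges at
the root stay there. -/
lemma IsStarGraphic.step {A B : Matroidal β} (hA : A.IsStarGraphic) (h : Step A B) :
    B.IsStarGraphic := by
  obtain ⟨V, _, _, p, q, hrep, hroot⟩ := hA
  cases h with
  | delete e heE heL hM hL => exact ⟨V, ‹_›, ‹_›, p, q, hM ▸ hrep.delete _, hL ▸ hroot⟩
  | remove e heL hM hL =>
    exact ⟨V, ‹_›, ‹_›, p, q, hM ▸ hrep, fun f hf => hroot f (hL ▸ hf : f ∈ A.L \ {e}).1⟩
  | contract e heE heL hM hL =>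
    by_cases h0 : edgeVec p q e = 0
    · exact ⟨V, ‹_›, ‹_›, p, q, hM ▸ hrep.contract_of_eq_zero heE h0, hL ▸ hroot⟩
    -- A non-loop has an end `y` other than the root; `a` is its other end, possibly the root.
    have hends : ∃ (y : V) (a : Option V), a ≠ some y ∧
        edgeVec p q e = rootedVec a + rootedVec (some y) := by
      rw [edgeVec_eq_zero] at h0
      cases hq : q e with
      | some y => exact ⟨y, p e, hq ▸ h0, by rw [edgeVec, hq]⟩
      | none =>
        obtain ⟨x, hx⟩ := Option.ne_none_iff_exists'.1 (hq ▸ h0)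
        exact ⟨x, none, by simp, by rw [edgeVec, hq, hx, add_comm]⟩
    obtain ⟨y, a, hay, hev⟩ := hends
    let f : Option V → Option V := fun b => if b = some y then a else b
    refine ⟨V, ‹_›, ‹_›, f ∘ p, f ∘ q, ?_, fun g hg => ?_⟩
    · rw [hM]
      refine hrep.contract heE h0 fun S _ => ?_
      have : ∀ g, edgeVec (f ∘ p) (f ∘ q) g = moveVertex y a (edgeVec p q g) := fun g => by
        rw [edgeVec, edgeVec, map_add, moveVertex_rootedVec, moveVertex_rootedVec]
        rfl
      simp only [this]
      rw [← map_sum, moveVertex_eq_zero hay, hev]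
    · refine (hroot g (hL ▸ hg)).imp ?_ ?_ <;> intro h' <;> simp [f, h']

lemma IsStarGraphic.isMinor {A B : Matroidal β} (hA : A.IsStarGraphic) (h : B.IsMinor A) :
    B.IsStarGraphic := by
  induction h with
  | refl => exact hA
  | tail _ h ih => exact ih.step h

end Matroidal

/-! ### The biased graph obtained by deleting the root -/

section HalfEdge

variable {V β : Type*} {p q : β → Option V} {E : Set β}

/-- The graph obtained from a graph with ends `p e`, `q e` by deleting the root `none` and turning
the edges at the root into loops at their other ends. (Loops at the root are kept as loops at an
isolated vertex.) -/
def halfEdgeGraph (p q : β → Option V) (E : Set β) : Graph (Option V) β where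
  vertexSet := univ
  edgeSet := E
  IsLink e x y := e ∈ E ∧ s(x, y) = s((p e).or (q e), (q e).or (p e))
  isLink_symm := fun e he => ⟨fun x y h => by rwa [Sym2.eq_swap]⟩
  eq_or_eq_of_isLink_of_isLink := by
    rintro e x y v w ⟨-, h1⟩ ⟨-, h2⟩
    have h := Sym2.eq_iff.1 (h1.trans h2.symm)
    tauto
  edge_mem_iff_exists_isLink := fun e =>
    ⟨fun he => ⟨_, _, he, rfl⟩, fun ⟨_, _, he, _⟩ => he⟩
  left_mem_of_isLink := fun _ _ _ _ => mem_univ _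

lemma halfEdgeGraph_isLoopAt {e : β} (he : e ∈ E) (hr : p e = none ∨ q e = none) :
    ∃ x, (halfEdgeGraph p q E).IsLoopAt e x := by
  refine ⟨(p e).or (q e), he, ?_⟩
  rcases hr with h | h <;> simp [h]

/-- `C` is a finite set of edges whose vectors sum to zero. -/
def IsZeroSum (v : β → V → ZMod 2) (C : Set β) : Prop :=
  ∃ S : Finset β, ↑S = C ∧ ∑ e ∈ S, v e = 0

lemma IsZeroSum.symmDiff {v : β → V → ZMod 2} {C D : Set β} (hC : IsZeroSum v C)
    (hD : IsZeroSum v D) : IsZeroSum v (symmDiff C D) := by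
  classical
  obtain ⟨S, rfl, hS⟩ := hC
  obtain ⟨T, rfl, hT⟩ := hD
  refine ⟨_root_.symmDiff S T, by simp, ?_⟩
  have h1 := Finset.sum_inter_add_sum_sdiff S T v
  have h2 := Finset.sum_inter_add_sum_sdiff T S v
  rw [hS] at h1
  rw [hT, Finset.inter_comm] at h2
  rw [symmDiff_def, Finset.sup_eq_union, Finset.sum_union (disjoint_sdiff_sdiff)]
  have h3 := congrArg₂ (· + ·) h1 h2
  simp only [add_zero] at h3
  rw [add_add_add_comm, ZModModule.add_self, zero_add] at h3
  exact h3

lemma isZeroSum_singleton {v : β → V → ZMod 2} {e : β} : IsZeroSum v {e} ↔ v e = 0 := by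
  constructor
  · rintro ⟨S, hS, h0⟩
    obtain rfl : S = {e} := by exact_mod_cast hS
    simpa using h0
  · intro h
    exact ⟨{e}, by simp, by simpa using h⟩

variable [DecidableEq V]

/-- The first case is that of a half edge, with exactly one end at the root: its vector is a single
unit vector although it is drawn as a loop. In the second case the edge is as in the original graph.
-/
lemma halfEdgeGraph_isLink_cases {e : β} {x y : Option V} (h : (halfEdgeGraph p q E).IsLink e x y) :
    (x ≠ none ∧ x = y ∧ edgeVec p q e = rootedVec x) ∨
      (edgeVec p q e = rootedVec x + rootedVec y ∧ (x = none ↔ y = none)) := by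
  obtain ⟨-, h⟩ := h
  rw [edgeVec]
  cases hp : p e with
  | none =>
    cases hq : q e with
    | none =>
      obtain ⟨rfl, rfl⟩ : x = none ∧ y = none := by simpa [hp, hq] using h
      right; simp
    | some b =>
      obtain ⟨rfl, rfl⟩ : x = some b ∧ y = some b := by simpa [hp, hq] using h
      left; simp
  | some a =>
    cases hq : q e with
    | none =>
      obtain ⟨rfl, rfl⟩ : x = some a ∧ y = some a := by simpa [hp, hq] using h
      left; simp
    | some b =>
      rw [hp, hq] at h
      rcases Sym2.eq_iff.1 h with ⟨rfl, rfl⟩ | ⟨rfl, rfl⟩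
      · right; simp
      · right; simp [add_comm]

lemma halfEdgeGraph_vec_of_ne {e : β} {x y : Option V} (h : (halfEdgeGraph p q E).IsLink e x y) (hxy : x ≠ y) :
    edgeVec p q e = rootedVec x + rootedVec y ∧ x ≠ none ∧ y ≠ none := by
  rcases halfEdgeGraph_isLink_cases h with ⟨-, h1, -⟩ | ⟨h1, h2⟩
  · exact absurd h1 hxy
  · refine ⟨h1, fun hx => hxy ?_, fun hy => hxy ?_⟩
    · rw [hx, h2.1 hx]
    · rw [hy, h2.2 hy]

lemma halfEdgeGraph_vec_of_loop {e : β} {x : Option V} (h : (halfEdgeGraph p q E).IsLink e x x) :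
    edgeVec p q e = 0 ∨ (edgeVec p q e = rootedVec x ∧ x ≠ none) := by
  rcases halfEdgeGraph_isLink_cases h with ⟨h1, -, h2⟩ | ⟨h1, -⟩
  · exact Or.inr ⟨h2, h1⟩
  · left
    rw [h1, ZModModule.add_self]

namespace Graph.IsPathBetween

lemma exists_sum_eq {x y : Option V} {U : Set (Option V)} {P : Set β}
    (h : (halfEdgeGraph p q E).IsPathBetween x y U P) :
    ∃ S : Finset β, ↑S = P ∧ ∑ e ∈ S, edgeVec p q e = rootedVec x + rootedVec y := by
  classical
  induction h with
  | nil x hx => exact ⟨∅, by simp, by rw [ZModModule.add_self, Finset.sum_empty]⟩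
  | cons x y z e U P he hx h ih =>
    obtain ⟨S, rfl, hS⟩ := ih
    have hxy : x ≠ y := fun h' => hx (h' ▸ h.left_mem)
    refine ⟨insert e S, by simp, ?_⟩
    rw [Finset.sum_insert fun he' => h.notMem_of_isLink he hx he', hS,
      (halfEdgeGraph_vec_of_ne he hxy).1, add_assoc, ← add_assoc (rootedVec y),
      ZModModule.add_self, zero_add]

lemma edgeVec_apply_eq_zero {x y : Option V} {U : Set (Option V)} {P : Set β}
    (h : (halfEdgeGraph p q E).IsPathBetween x y U P) {e : β} (he : e ∈ P) {v : V} (hv : some v ∉ U) :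
    edgeVec p q e v = 0 := by
  obtain ⟨z, w, hzw⟩ := (halfEdgeGraph p q E).exists_isLink_of_mem_edgeSet (h.mem_edgeSet he)
  obtain ⟨hz, hw⟩ := h.mem_of_isLink he hzw
  have hz' : z ≠ some v := fun h' => hv (h' ▸ hz)
  have hw' : w ≠ some v := fun h' => hv (h' ▸ hw)
  rw [(halfEdgeGraph_vec_of_ne hzw (h.ne_of_isLink he hzw)).1]
  simp [rootedVec, hz', hw']

/-- The edges of a path, together with an independent set of edges that avoids all vertices of the
path but the last, are independent. -/
lemma indep_union {x y : Option V} {U : Set (Option V)} {P : Set β}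
    (h : (halfEdgeGraph p q E).IsPathBetween x y U P) {Q : Set β}
    (hQ : ∀ T : Finset β, ↑T ⊆ Q → ∑ e ∈ T, edgeVec p q e = 0 → T = ∅)
    (hQU : ∀ g ∈ Q, ∀ v, some v ∈ U → some v ≠ y → edgeVec p q g v = 0) {T : Finset β}
    (hT : ↑T ⊆ P ∪ Q) (h0 : ∑ e ∈ T, edgeVec p q e = 0) : T = ∅ := by
  classical
  induction h with
  | nil x hx => exact hQ T (by simpa using hT) h0
  | cons x y z e U P he hx h ih =>
    have hxy : x ≠ y := fun h' => hx (h' ▸ h.left_mem)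
    have hxz : x ≠ z := fun h' => hx (h' ▸ h.right_mem)
    obtain ⟨hev, hxn, -⟩ := halfEdgeGraph_vec_of_ne he hxy
    obtain ⟨x, rfl⟩ := Option.ne_none_iff_exists'.1 hxn
    -- Only the first edge of the path has a nonzero coordinate at the first vertex, so a zero sum
    -- cannot use it.
    have hother : ∀ f ∈ T, f ≠ e → edgeVec p q f x = 0 := by
      intro f hf hfe
      rcases hT hf with (rfl | hfP) | hfQ
      · exact absurd rfl hfe
      · exact h.edgeVec_apply_eq_zero hfP hx
      · exact hQU f hfQ x (mem_insert _ _) hxz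
    have heT : e ∉ T := by
      intro heT
      have h1 := congrFun h0 x
      rw [Finset.sum_apply, Finset.sum_eq_single_of_mem e heT hother, hev] at h1
      simp [rootedVec, Ne.symm hxy] at h1
    refine ih (fun g hg v hv hvz => hQU g hg v (mem_insert_of_mem _ hv) hvz) fun f hf => ?_
    rcases hT hf with (rfl | hfP) | hfQ
    · exact absurd hf heT
    · exact Or.inl hfP
    · exact Or.inr hfQ

lemma indep {x y : Option V} {U : Set (Option V)} {P : Set β}
    (h : (halfEdgeGraph p q E).IsPathBetween x y U P) {T : Finset β} (hT : ↑T ⊆ P) (h0 : ∑ e ∈ T, edgeVec p q e = 0) :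
    T = ∅ :=
  h.indep_union (Q := ∅) (fun T hT _ => by simpa using hT) (by simp) (by simpa using hT) h0

end Graph.IsPathBetween

/-- The biased graph on `halfEdgeGraph p q E` in which a cycle is balanced if its vectors sum to
zero, which fails only for the loops arising from edges at the root. -/
def halfEdgeBiasedGraph [Finite V] (p q : β → Option V) (hE : E.Finite) :
    BiasedGraph (Option V) β where
  graph := halfEdgeGraph p q E
  vertexSet_finite := toFinite _
  edgeSet_finite := hE
  balanced := {C | (halfEdgeGraph p q E).IsCycleSet C ∧ IsZeroSum (edgeVec p q) C}
  isCycleSet_of_balanced := fun _ hC => hC.1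
  theta_property := by
    intro P₁ P₂ P₃ h h12 h13
    refine ⟨h.isCycleSet.2.2, ?_⟩
    have hsd := h12.2.symmDiff h13.2
    obtain ⟨-, -, -, -, -, -, -, -, -, -, -, -, d12, d13, d23⟩ := h
    -- For disjoint paths, `P₂ ∪ P₃` is the symmetric difference of `P₁ ∪ P₂` and `P₁ ∪ P₃`.
    convert hsd using 1
    ext e
    have : e ∈ P₁ → e ∉ P₂ := fun h' => disjoint_left.1 d12 h'
    have : e ∈ P₁ → e ∉ P₃ := fun h' => disjoint_left.1 d13 h'
    have : e ∈ P₂ → e ∉ P₃ := fun h' => disjoint_left.1 d23 h'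
    simp only [mem_union, Set.mem_symmDiff]
    tauto

namespace Matroid.IsBinaryRep

variable {M : Matroid β}

/-- The vectors of a path are independent and telescope to the sum of its ends, which is the vector
of the closing edge unless that edge is a half edge. Hence half edges are the only unbalanced
cycles. -/
lemma isCircuit_of_isCycleSet (h : M.IsBinaryRep (edgeVec p q)) {C : Set β}
    (hC : (halfEdgeGraph p q M.E).IsCycleSet C) :
    (M.IsCircuit C ∧ IsZeroSum (edgeVec p q) C) ∨ ∃ f x, C = {f} ∧
      (halfEdgeGraph p q M.E).IsLink f x x ∧ x ≠ none ∧ edgeVec p q f = rootedVec x := by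
  classical
  obtain ⟨x, y, U, P, f, hP, hf, hfP, rfl⟩ := hC
  have hsum : edgeVec p q f = rootedVec x + rootedVec y →
      M.IsCircuit (insert f P) ∧ IsZeroSum (edgeVec p q) (insert f P) := by
    intro hv
    obtain ⟨S, rfl, hS⟩ := hP.exists_sum_eq
    have h0 : ∑ e ∈ insert f S, edgeVec p q e = 0 := by
      rw [Finset.sum_insert hfP, hS, hv, ZModModule.add_self]
    rw [← Finset.coe_insert]
    refine ⟨h.isCircuit (f := f) ?_ (Finset.mem_insert_self _ _) h0 ?_, _, rfl, h0⟩
    · rw [Finset.coe_insert]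
      exact insert_subset hf.edge_mem fun e he => hP.mem_edgeSet he
    · intro T hT hfT hT0
      refine hP.indep (fun e he => ?_) hT0
      exact (Finset.mem_insert.1 (hT he)).resolve_left fun h' => hfT (h' ▸ he)
  rcases halfEdgeGraph_isLink_cases hf with ⟨hx, rfl, hv⟩ | ⟨hv, -⟩
  · right
    exact ⟨f, x, by rw [hP.eq_empty, insert_empty_eq], hf, hx, hv⟩
  · exact Or.inl (hsum hv)

/-- Two half edges at the ends of a path form a circuit with it. -/
lemma isCircuit_handcuff (h : M.IsBinaryRep (edgeVec p q)) {f g : β} {x y : Option V} {U : Set (Option V)}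
    {P : Set β} (hfg : f ≠ g) (hf : (halfEdgeGraph p q M.E).IsLink f x x)
    (hg : (halfEdgeGraph p q M.E).IsLink g y y) (hfx : edgeVec p q f = rootedVec x)
    (hgy : edgeVec p q g = rootedVec y) (hy : y ≠ none)
    (hP : (halfEdgeGraph p q M.E).IsPathBetween x y U P) : M.IsCircuit ({f} ∪ {g} ∪ P) := by
  classical
  have hfP : f ∉ P := fun h' => hP.ne_of_isLink h' hf rfl
  have hgP : g ∉ P := fun h' => hP.ne_of_isLink h' hg rfl
  obtain ⟨S, rfl, hS⟩ := hP.exists_sum_eq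
  have : ({f} ∪ {g} ∪ ↑S : Set β) = ↑(insert f (insert g S)) := by
    push_cast
    rw [union_assoc, singleton_union, singleton_union]
  rw [this]
  have hfS : f ∉ insert g S := by simpa [hfg] using hfP
  refine h.isCircuit (f := f) ?_ (Finset.mem_insert_self _ _) ?_ ?_
  · push_cast
    exact insert_subset hf.edge_mem (insert_subset hg.edge_mem fun e he => hP.mem_edgeSet he)
  · rw [Finset.sum_insert hfS, Finset.sum_insert hgP, hS, hfx, hgy, ← add_assoc,
      ZModModule.add_self]
  · intro T hT hfT h0
    -- A subset without `f` lies in the path plus `g`, and `g` lives at the last vertex `y` only.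
    refine hP.indep_union (Q := {g}) ?_ ?_ (fun e he => ?_) h0
    · intro T hT h0
      rcases Finset.subset_singleton_iff.1 (show T ⊆ {g} by exact_mod_cast hT) with rfl | rfl
      · rfl
      · rw [Finset.sum_singleton, hgy, rootedVec_eq_zero] at h0
        exact absurd h0 hy
    · rintro _ rfl v - hv
      rw [hgy, rootedVec, if_neg hv.symm]
    · rcases Finset.mem_insert.1 (hT he) with rfl | he'
      · exact absurd he hfT
      · rcases Finset.mem_insert.1 he' with rfl | he''
        · exact Or.inr rfl
        · exact Or.inl he''

variable [Finite V]

/-- Since unbalanced cycles are single half edges, every handcuff is a pair of half edges with a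
path, and no theta is contrabalanced, as thetas contain no loops. -/
lemma isCircuit_of_isFrameCircuit (h : M.IsBinaryRep (edgeVec p q)) (hE : M.E.Finite) {C : Set β}
    (hC : (halfEdgeBiasedGraph p q hE).IsFrameCircuit C) : M.IsCircuit C := by
  have hunb : ∀ D, (halfEdgeBiasedGraph p q hE).IsUnbalancedCycle D → ∃ f x, D = {f} ∧
      (halfEdgeGraph p q M.E).IsLink f x x ∧ x ≠ none ∧ edgeVec p q f = rootedVec x := by
    rintro D ⟨hD, hDb⟩
    refine (h.isCircuit_of_isCycleSet hD).resolve_left fun h' => hDb ⟨hD, h'.2⟩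
  rcases hC with hC | hC | hC | hC
  · rcases h.isCircuit_of_isCycleSet hC.1 with h1 | ⟨f, x, rfl, -, hx, hv⟩
    · exact h1.1
    · have := isZeroSum_singleton.1 hC.2
      rw [hv, rootedVec_eq_zero] at this
      exact absurd this hx
  · obtain ⟨C₁, C₂, h1, h2, hdj, ⟨v, hv⟩, rfl⟩ := hC
    obtain ⟨f, x, rfl, hf, hx, hfx⟩ := hunb _ h1
    obtain ⟨g, y, rfl, hg, hy, hgy⟩ := hunb _ h2
    have hv' : v ∈ (halfEdgeGraph p q M.E).verts {f} ∩ (halfEdgeGraph p q M.E).verts {g} := by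
      exact hv.symm ▸ mem_singleton v
    rw [Graph.verts_singleton_of_isLoopAt hf, Graph.verts_singleton_of_isLoopAt hg] at hv'
    obtain rfl : x = y := hv'.1.symm.trans hv'.2
    have := h.isCircuit_handcuff (by simpa using hdj) hf hg hfx hgy hy
      (.nil x (mem_univ _))
    rwa [union_empty] at this
  · obtain ⟨C₁, C₂, x', y', U, P, h1, h2, hdj, hP, hU1, hU2, rfl⟩ := hC
    obtain ⟨f, x, rfl, hf, hx, hfx⟩ := hunb _ h1
    obtain ⟨g, y, rfl, hg, hy, hgy⟩ := hunb _ h2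
    change (halfEdgeGraph p q M.E).IsPathBetween x' y' U P at hP
    change Disjoint ((halfEdgeGraph p q M.E).verts {f}) ((halfEdgeGraph p q M.E).verts {g}) at hdj
    change U ∩ (halfEdgeGraph p q M.E).verts {f} = {x'} at hU1
    change U ∩ (halfEdgeGraph p q M.E).verts {g} = {y'} at hU2
    rw [Graph.verts_singleton_of_isLoopAt hf] at hdj hU1
    rw [Graph.verts_singleton_of_isLoopAt hg] at hdj hU2
    obtain rfl : x' = x := (hU1 ▸ mem_singleton x' : x' ∈ U ∩ {x}).2
    obtain rfl : y' = y := (hU2 ▸ mem_singleton y' : y' ∈ U ∩ {y}).2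
    refine h.isCircuit_handcuff ?_ hf hg hfx hgy hy hP
    rintro rfl
    rw [disjoint_singleton] at hdj
    rcases hf.eq_and_eq_or_eq_and_eq hg with h' | h' <;> exact hdj h'.1
  · obtain ⟨P₁, P₂, P₃, hth, h12, -⟩ := hC
    obtain ⟨f, x, hfe, hf, -⟩ := hunb _ ⟨hth.isCycleSet.1, h12⟩
    have : f ∈ P₁ ∪ P₂ := hfe ▸ mem_singleton f
    exact absurd rfl (hth.ne_of_isLink (mem_union_left _ this) hf)

/-- A cut argument. Fix an edge `f` of the zero-sum set `S` and let `R` be the set of vertices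
joined to an end `y` of `f` by paths in `S \ {f}`. If `S` contained no frame circuit, `f` would be
the only edge of `S` on which the sum `ψ` of the coordinates in `R` is nonzero, contradicting the
zero sum. -/
lemma exists_isFrameCircuit_subset (h : M.IsBinaryRep (edgeVec p q)) (hE : M.E.Finite) {C : Set β}
    (hC : M.IsCircuit C) : ∃ D ⊆ C, (halfEdgeBiasedGraph p q hE).IsFrameCircuit D := by
  classical
  obtain ⟨S, rfl, ⟨e₀, he₀⟩, h0⟩ := h.exists_of_isCircuit hC
  by_contra! hcon
  have hcycle : ∀ D ⊆ (S : Set β), (halfEdgeGraph p q M.E).IsCycleSet D →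
      (halfEdgeBiasedGraph p q hE).IsUnbalancedCycle D :=
    fun D hD hDc => ⟨hDc, fun hb => hcon D hD (Or.inl hb)⟩
  -- Take `f` to be a half edge if `S` has a loop, and any edge otherwise. Loops with zero vector
  -- are excluded, being balanced cycles.
  have key : ∃ f ∈ S, ∃ x y, (halfEdgeGraph p q M.E).IsLink f x y ∧ y ≠ none ∧
      ((x ≠ y ∧ ∀ g ∈ S, ∀ z, ¬ (halfEdgeGraph p q M.E).IsLink g z z) ∨
        (x = y ∧ edgeVec p q f = rootedVec y)) := by
    by_cases hl : ∃ f ∈ S, ∃ x, (halfEdgeGraph p q M.E).IsLink f x x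
    · obtain ⟨f, hf, x, hx⟩ := hl
      have hne : edgeVec p q f ≠ 0 := fun hv => (hcycle {f} (by simpa using hf)
        (Graph.isCycleSet_of_isLoopAt hx)).2 ⟨Graph.isCycleSet_of_isLoopAt hx,
          isZeroSum_singleton.2 hv⟩
      rcases halfEdgeGraph_vec_of_loop hx with h1 | ⟨h1, h2⟩
      · exact absurd h1 hne
      · exact ⟨f, hf, x, x, hx, h2, Or.inr ⟨rfl, h1⟩⟩
    · push Not at hl
      obtain ⟨x, y, hxy⟩ := (halfEdgeGraph p q M.E).exists_isLink_of_mem_edgeSet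
        (hC.subset_ground he₀)
      have hne : x ≠ y := fun h' => hl e₀ he₀ y (h' ▸ hxy)
      exact ⟨e₀, he₀, x, y, hxy, (halfEdgeGraph_vec_of_ne hxy hne).2.2, Or.inl ⟨hne, hl⟩⟩
  obtain ⟨f, hfS, x, y, hxy, hy, hcase⟩ := key
  let R : Set (Option V) :=
    {z | ∃ U P, P ⊆ (S : Set β) \ {f} ∧ (halfEdgeGraph p q M.E).IsPathBetween z y U P}
  have hyR : y ∈ R := ⟨_, _, empty_subset _, .nil y (mem_univ _)⟩
  have hstep : ∀ e ∈ (S : Set β) \ {f}, ∀ z w, (halfEdgeGraph p q M.E).IsLink e z w →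
      z ∈ R → w ∈ R := by
    rintro e he z w hzw ⟨U, P, hP, hp⟩
    by_cases hw : w ∈ U
    · obtain ⟨U₁, P₁, hP₁, h₁⟩ := hp.suffix hw
      exact ⟨U₁, P₁, hP₁.trans hP, h₁⟩
    · exact ⟨_, _, insert_subset he hP, .cons _ _ _ _ _ _ hzw.symm hw hp⟩
  have : Fintype V := Fintype.ofFinite V
  let ψ : (V → ZMod 2) →ₗ[ZMod 2] ZMod 2 := ∑ v with some v ∈ R, LinearMap.proj v
  have hψ : ∀ a : Option V, a ≠ none → ψ (rootedVec a) = if a ∈ R then 1 else 0 := by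
    intro a ha
    obtain ⟨v, rfl⟩ := Option.ne_none_iff_exists'.1 ha
    simp only [ψ, LinearMap.sum_apply, LinearMap.proj_apply, rootedVec, Option.some.injEq]
    rw [Finset.sum_ite_eq]
    simp
  -- a path from `z` to `y` avoiding `f` and a half edge at `z` would give a handcuff with `f`
  have hnot : x = y → edgeVec p q f = rootedVec y → ∀ g ∈ (S : Set β) \ {f}, ∀ z,
      (halfEdgeGraph p q M.E).IsLink g z z → z ∉ R := by
    rintro rfl hv g hg z hz ⟨U, P, hP, hp⟩
    have hgc := hcycle {g} (by simpa using hg.1) (Graph.isCycleSet_of_isLoopAt hz)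
    have hfc := hcycle {f} (by simpa using hfS) (Graph.isCycleSet_of_isLoopAt hxy)
    have hvg : (halfEdgeBiasedGraph p q hE).graph.verts {g} = {z} :=
      Graph.verts_singleton_of_isLoopAt hz
    have hvf : (halfEdgeBiasedGraph p q hE).graph.verts {f} = {x} :=
      Graph.verts_singleton_of_isLoopAt hxy
    by_cases hzx : z = x
    · subst hzx
      refine hcon ({g} ∪ {f}) ?_ (Or.inr (Or.inl ⟨{g}, {f}, hgc, hfc, ?_, ⟨z, ?_⟩, rfl⟩))
      · exact union_subset (by simpa using hg.1) (by simpa using hfS)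
      · simpa using hg.2
      · rw [hvg, hvf, inter_self]
    · refine hcon ({g} ∪ {f} ∪ P) ?_ (Or.inr (Or.inr (Or.inl
        ⟨{g}, {f}, z, x, U, P, hgc, hfc, ?_, hp, ?_, ?_, rfl⟩)))
      · exact union_subset (union_subset (by simpa using hg.1) (by simpa using hfS))
          (hP.trans sdiff_subset)
      · rw [hvg, hvf]
        simpa using hzx
      · rw [hvg, inter_eq_right]
        simpa using hp.left_mem
      · rw [hvf, inter_eq_right]
        simpa using hp.right_mem
  -- Links other than `f` do not leave `R`, and half edges other than `f` are not at vertices of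
  -- `R`.
  have hsum0 : ∀ e ∈ S, e ≠ f → ψ (edgeVec p q e) = 0 := by
    intro e he hef
    obtain ⟨z, w, hzw⟩ := (halfEdgeGraph p q M.E).exists_isLink_of_mem_edgeSet
      (hC.subset_ground he)
    by_cases hne : z = w
    · subst hne
      rcases halfEdgeGraph_vec_of_loop hzw with h1 | ⟨h1, h2⟩
      · rw [h1, map_zero]
      · rcases hcase with ⟨-, h3⟩ | ⟨hxy', hv⟩
        · exact absurd hzw (h3 e he z)
        · rw [h1, hψ z h2, if_neg (hnot hxy' hv e ⟨he, hef⟩ z hzw)]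
    · obtain ⟨h1, h2, h3⟩ := halfEdgeGraph_vec_of_ne hzw hne
      have hiff : z ∈ R ↔ w ∈ R := ⟨hstep e ⟨he, hef⟩ z w hzw, hstep e ⟨he, hef⟩ w z hzw.symm⟩
      simp only [h1, map_add, hψ z h2, hψ w h3, hiff, ZModModule.add_self]
  have hf0 : ψ (edgeVec p q f) = 0 := by
    have := congrArg ψ h0
    rwa [map_sum, map_zero, Finset.sum_eq_single_of_mem f hfS hsum0] at this
  -- If `f` is a link, then `x` also lies in `R` and `f` closes a cycle, which is balanced because
  -- it is not a half edge. If `f` is a half edge at `y`, then `ψ` takes the value 1 on it.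
  rcases hcase with ⟨hne, -⟩ | ⟨-, hv⟩
  · obtain ⟨h1, h2, -⟩ := halfEdgeGraph_vec_of_ne hxy hne
    rw [h1, map_add, hψ x h2, hψ y hy, if_pos hyR] at hf0
    have hxR : x ∈ R := by
      by_contra hx
      rw [if_neg hx] at hf0
      exact absurd hf0 (by decide)
    obtain ⟨U, P, hP, hp⟩ := hxR
    have hcyc : (halfEdgeGraph p q M.E).IsCycleSet (insert f P) :=
      ⟨x, y, U, P, f, hp, hxy, fun h' => (hP h').2 rfl, rfl⟩
    have hunb := hcycle _ (insert_subset hfS (hP.trans sdiff_subset)) hcyc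
    rcases h.isCircuit_of_isCycleSet hcyc with h3 | ⟨g, z, hg, hz, -⟩
    · exact hunb.2 ⟨hcyc, h3.2⟩
    · obtain rfl : f = g := by
        have : f ∈ ({g} : Set β) := hg ▸ mem_insert _ _
        exact this
      rcases hxy.eq_and_eq_or_eq_and_eq hz with ⟨h4, h5⟩ | ⟨h4, h5⟩ <;> exact hne (h4.trans h5.symm)
  · rw [hv, hψ y hy, if_pos hyR] at hf0
    exact one_ne_zero hf0

lemma represents (h : M.IsBinaryRep (edgeVec p q)) (hE : M.E.Finite) :
    (halfEdgeBiasedGraph p q hE).Represents M := by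
  refine ⟨rfl, fun C => ⟨fun hC => ?_, h.isCircuit_of_isFrameCircuit hE⟩⟩
  obtain ⟨D, hDC, hD⟩ := h.exists_isFrameCircuit_subset hE hC
  -- Circuits form an antichain, so a frame circuit inside `C` is `C` itself.
  rwa [(h.isCircuit_of_isFrameCircuit hE hD).eq_of_subset_isCircuit hC hDC] at hD

end Matroid.IsBinaryRep

end HalfEdge

namespace Matroidal

lemma IsStarGraphic.isFrame {β : Type*} [Finite β] {A : Matroidal β} (hA : A.IsStarGraphic)
    (hl : A.LoopFree) : A.IsFrame := by
  obtain ⟨V, _, _, p, q, hrep, hroot⟩ := hA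
  refine ⟨Option V, halfEdgeBiasedGraph p q (toFinite A.M.E), hrep.represents _, fun e he => ?_⟩
  refine ⟨halfEdgeGraph_isLoopAt (A.subset_ground he) (hroot e he), fun hb => hl e he ?_⟩
  exact (hrep.isLoop_iff (A.subset_ground he)).2 (isZeroSum_singleton.1 hb.2)

end Matroidal

/-! ### The wheel and its minors by one step -/

namespace Graph

/-- The incidence vectors modulo two represent the cycle matroid. -/
lemma isBinaryRep_cycleMatroid {α β : Type*} [DecidableEq α] {G : Graph α β}
    (hE : G.edgeSet.Finite) {a b : β → α} (hab : ∀ e ∈ G.edgeSet, G.IsLink e (a e) (b e)) :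
    (G.cycleMatroid hE).IsBinaryRep (edgeVec (fun e => some (a e)) fun e => some (b e)) := by
  have h : (G.cycleMatroid hE).IsBinaryRep (incVec G) := by
    intro I
    change (I ⊆ G.edgeSet ∧ ∀ C ⊆ I, ¬ G.IsCycleSet C) ↔ I ⊆ G.edgeSet ∧ _
    refine and_congr_right fun hI => ?_
    rw [acyclic_iff hI, Matroid.linearIndepOn_zmod_two_iff]
  refine h.congr fun S hS => ?_
  rw [← DFunLike.coe_fn_eq (F := α →₀ ZMod 2), Finsupp.coe_zero, Finsupp.coe_finsetSum]
  have hsum : ∑ e ∈ S, edgeVec (fun e => some (a e)) (fun e => some (b e)) e =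
      ∑ e ∈ S, ⇑(incVec G e) := by
    refine Finset.sum_congr rfl fun e he => ?_
    rw [incVec_eq (hab e (hS he))]
    ext v
    simp [edgeVec, rootedVec, Finsupp.single_apply]
  rw [hsum]

end Graph

/-- The ends of the edges of `wheelFour`. -/
def wheelEnds : Fin 4 ⊕ Fin 4 → Option (Fin 4) × Option (Fin 4)
  | .inl i => (some i, some (i + 1))
  | .inr i => (none, some i)

/-- Declare the vertex `r` to be the root. -/
def rootAt {V : Type*} [DecidableEq V] (r x : V) : Option V := if x = r then none else some x

/-- The incidence vector of an edge of the graph with ends `f e`, without the coordinate of the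
root `r`. -/
def rootedEdgeVec (r : Option (Fin 4)) (f : Fin 4 ⊕ Fin 4 → Option (Fin 4) × Option (Fin 4)) :
    Fin 4 ⊕ Fin 4 → Option (Fin 4) → ZMod 2 :=
  edgeVec (fun e => rootAt r (f e).1) fun e => rootAt r (f e).2

/-- The incidence vectors of `wheelFour`. -/
def wheelVec : Fin 4 ⊕ Fin 4 → Option (Fin 4) → ZMod 2 :=
  edgeVec (fun e => some (wheelEnds e).1) fun e => some (wheelEnds e).2

lemma isBinaryRep_matroidalEight : matroidalEight.M.IsBinaryRep wheelVec := by
  refine Graph.isBinaryRep_cycleMatroid _ fun e _ => ?_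
  rcases e with i | i <;> rfl

/-- A root and ends of the edges of a graph for `M(W₄) ＼ e`, for `e` not in `{inl 0, inl 2}`, in
which the edges `inl 0` and `inl 2` meet the root: edges in series are interchanged. -/
def deleteEnds : Fin 4 ⊕ Fin 4 → Option (Fin 4) × (Fin 4 ⊕ Fin 4 → Option (Fin 4) × Option (Fin 4))
  | .inl i => (none, fun e => wheelEnds
      (Equiv.swap (.inl (i - 1)) (.inr i) (Equiv.swap (.inl (i + 1)) (.inr (i + 1)) e)))
  | .inr i => (some (-(i + 1)), fun e => wheelEnds (Equiv.swap (.inl i) (.inl (i - 1)) e))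

/-- The ends of the edges of `W₄ ／ inr i`: the vertex `i` is identified with the hub. -/
def spokeContractEnds (i : Fin 4) (e : Fin 4 ⊕ Fin 4) : Option (Fin 4) × Option (Fin 4) :=
  Prod.map (fun x => if x = some i then none else x) (fun x => if x = some i then none else x)
    (wheelEnds e)

/-- A root and ends of the edges of a graph for `M(W₄) ／ e`, for `e` not in `{inl 0, inl 2}`, in
which the edges `inl 0` and `inl 2` meet the root. The contraction of a spoke `inr i` is twisted
about the hub and `i + 2`. -/
def contractEnds : Fin 4 ⊕ Fin 4 →
    Option (Fin 4) × (Fin 4 ⊕ Fin 4 → Option (Fin 4) × Option (Fin 4))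
  | .inl i => (some (i + 1), fun e => Prod.map (fun x => if x = some i then some (i + 1) else x)
      (fun x => if x = some i then some (i + 1) else x) (wheelEnds e))
  | .inr i => (if i = 0 ∨ i = 2 then some (i + 2) else none, fun e =>
      if (spokeContractEnds i e).1 = some (i + 1) ∨ (spokeContractEnds i e).2 = some (i + 1) then
        Prod.map (Equiv.swap none (some (i + 2))) (Equiv.swap none (some (i + 2)))
          (spokeContractEnds i e)
      else spokeContractEnds i e)

/-- The coordinates of an incidence vector sum to zero, so the coordinate at the root is redundant.
-/
lemma sum_wheelEnds_iff : ∀ (r : Option (Fin 4)) (S : Finset (Fin 4 ⊕ Fin 4)),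
    ∑ f ∈ S, rootedEdgeVec r wheelEnds f = 0 ↔ ∑ f ∈ S, wheelVec f = 0 := by
  decide +kernel

/-- Deletion leaves vertices of degree two. Without the rim edge `inl i`, its two ends have this
degree, and the swaps turn `inl 0` and `inl 2` into spokes. Without the spoke `inr i`, the rim edges
at `i` are in series, and swapping them makes the distinguished one adjacent to the other
distinguished edge, at `-(i + 1)`. -/
lemma sum_deleteEnds_iff : ∀ e : Fin 4 ⊕ Fin 4, e ≠ .inl 0 → e ≠ .inl 2 →
    ∀ S : Finset (Fin 4 ⊕ Fin 4), e ∉ S →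
      (∑ f ∈ S, rootedEdgeVec (deleteEnds e).1 (deleteEnds e).2 f = 0 ↔
        ∑ f ∈ S, wheelVec f = 0) := by
  decide +kernel

lemma deleteEnds_root : ∀ e : Fin 4 ⊕ Fin 4, e ≠ .inl 0 → e ≠ .inl 2 →
    ∀ f : Fin 4 ⊕ Fin 4, f = .inl 0 ∨ f = .inl 2 →
      rootAt (deleteEnds e).1 ((deleteEnds e).2 f).1 = none ∨
        rootAt (deleteEnds e).1 ((deleteEnds e).2 f).2 = none := by
  decide +kernel

set_option synthInstance.maxSize 1000 in
-- Contracting `inl 1` or `inl 3` makes the distinguished edges meet. Contracting `inr i` makes the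
-- hub and `i + 2` a vertex cut separating `i + 1` from `i + 3`. Twisting the edges at `i + 1` moves
-- one distinguished edge to the end of the other in this cut: `i + 2` for even `i`, the hub for odd
-- `i`.
lemma sum_contractEnds_iff : ∀ e : Fin 4 ⊕ Fin 4, e ≠ .inl 0 → e ≠ .inl 2 →
    ∀ S : Finset (Fin 4 ⊕ Fin 4), e ∉ S →
      (∑ f ∈ S, rootedEdgeVec (contractEnds e).1 (contractEnds e).2 f = 0 ↔
        ∑ f ∈ S, wheelVec f = 0 ∨ ∑ f ∈ S, wheelVec f = wheelVec e) := by
  decide +kernel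

lemma contractEnds_root : ∀ e : Fin 4 ⊕ Fin 4, e ≠ .inl 0 → e ≠ .inl 2 →
    ∀ f : Fin 4 ⊕ Fin 4, f = .inl 0 ∨ f = .inl 2 →
      rootAt (contractEnds e).1 ((contractEnds e).2 f).1 = none ∨
        rootAt (contractEnds e).1 ((contractEnds e).2 f).2 = none := by
  decide +kernel

lemma wheelVec_ne_zero : ∀ e, wheelVec e ≠ 0 := by
  decide +kernel

lemma isStarGraphic_of_step {B : Matroidal (Fin 4 ⊕ Fin 4)} (h : Matroidal.Step matroidalEight B) :
    B.IsStarGraphic := by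
  cases h with
  | delete e heE heL hM hL =>
    have h0 : e ≠ .inl 0 := fun h => heL (Or.inl h)
    have h2 : e ≠ .inl 2 := fun h => heL (Or.inr h)
    refine ⟨Option (Fin 4), inferInstance, inferInstance, _, _, ?_,
      fun f hf => deleteEnds_root e h0 h2 f (by rwa [hL] at hf)⟩
    rw [hM]
    refine (isBinaryRep_matroidalEight.delete {e}).congr fun S hS => ?_
    exact sum_deleteEnds_iff e h0 h2 S fun he => (hS he).2 rfl
  | contract e heE heL hM hL =>
    have h0 : e ≠ .inl 0 := fun h => heL (Or.inl h)
    have h2 : e ≠ .inl 2 := fun h => heL (Or.inr h)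
    refine ⟨Option (Fin 4), inferInstance, inferInstance, _, _, ?_,
      fun f hf => contractEnds_root e h0 h2 f (by rwa [hL] at hf)⟩
    rw [hM]
    exact isBinaryRep_matroidalEight.contract heE (wheelVec_ne_zero e)
      (sum_contractEnds_iff e h0 h2)
  | remove e heL hM hL =>
    have key : ∀ r : Option (Fin 4), (∀ f ∈ B.L, rootAt r (wheelEnds f).1 = none ∨
        rootAt r (wheelEnds f).2 = none) → B.IsStarGraphic := fun r hr =>
      ⟨Option (Fin 4), inferInstance, inferInstance, _, _,
        hM ▸ isBinaryRep_matroidalEight.congr fun S _ => sum_wheelEnds_iff r S, hr⟩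
    -- Any end of the remaining distinguished edge serves as root.
    rcases heL with rfl | rfl
    · refine key (some 2) fun f hf => ?_
      rw [hL] at hf
      obtain ⟨rfl | rfl, hne⟩ := hf
      · exact absurd rfl hne
      · exact Or.inl rfl
    · refine key (some 0) fun f hf => ?_
      rw [hL] at hf
      obtain ⟨rfl | rfl, hne⟩ := hf
      · exact Or.inl rfl
      · exact absurd rfl hne

lemma matroidalEight_isCircuit {S : Finset (Fin 4 ⊕ Fin 4)} {f : Fin 4 ⊕ Fin 4} (hf : f ∈ S)
    (h0 : ∑ e ∈ S, wheelVec e = 0)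
    (hmin : ∀ T ⊆ S, f ∉ T → ∑ e ∈ T, wheelVec e = 0 → T = ∅) :
    matroidalEight.M.IsCircuit (S : Set (Fin 4 ⊕ Fin 4)) :=
  isBinaryRep_matroidalEight.isCircuit (subset_univ _) hf h0 hmin

/-! ### Frame circuits through loops, and the wheel -/

namespace Graph

/-- Each edge of a path with two edges is incident with an end of the path. -/
lemma IsPathBetween.inc_of_pair {α β : Type*} {G : Graph α β} {x y : α} {U : Set α} {e f : β}
    (hef : e ≠ f) (h : G.IsPathBetween x y U {e, f}) : G.Inc e x ∨ G.Inc e y := by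
  generalize hP : ({e, f} : Set β) = P at h
  cases h with
  | nil => exact absurd hP (insert_nonempty _ _).ne_empty
  | cons _ w _ g U P hg hx h =>
    have hgP := h.notMem_of_isLink hg hx
    have hPe : P = {e, f} \ {g} := by
      rw [hP, insert_sdiff_of_mem _ (mem_singleton _), sdiff_singleton_eq_self hgP]
    have hge : g ∈ ({e, f} : Set β) := hP ▸ mem_insert _ _
    rcases hge with rfl | rfl
    · exact Or.inl ⟨w, hg⟩
    · obtain rfl : P = {e} := by rw [hPe]; ext a; simp; grind
      exact Or.inr ⟨w, h.isLink_of_singleton.symm⟩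

end Graph

namespace BiasedGraph

variable {α β : Type*} {Ω : BiasedGraph α β}

/-- A circuit of the frame matroid that properly contains two unbalanced loops consists of them
and a path. -/
lemma IsFrameCircuit.exists_path {C : Set β} (hC : Ω.IsFrameCircuit C) {e f : β} {x y : α}
    (hef : e ≠ f) (he : e ∈ C) (hf : f ∈ C) (hex : Ω.graph.IsLink e x x)
    (hfy : Ω.graph.IsLink f y y) (hne : C ≠ {e, f}) :
    ∃ U P, Ω.graph.IsPathBetween x y U P ∧ C = {e, f} ∪ P := by
  have key : ∀ C₁ C₂, Ω.IsUnbalancedCycle C₁ → Ω.IsUnbalancedCycle C₂ → e ∈ C₁ ∪ C₂ →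
      f ∈ C₁ ∪ C₂ → (C₁ = {e} ∧ C₂ = {f}) ∨ (C₁ = {f} ∧ C₂ = {e}) := by
    rintro C₁ C₂ h1 h2 (he | he) (hf | hf)
    · exact absurd ((h1.1.eq_singleton he hex) ▸ hf : f ∈ ({e} : Set β)) hef.symm
    · exact Or.inl ⟨h1.1.eq_singleton he hex, h2.1.eq_singleton hf hfy⟩
    · exact Or.inr ⟨h1.1.eq_singleton hf hfy, h2.1.eq_singleton he hex⟩
    · exact absurd ((h2.1.eq_singleton he hex) ▸ hf : f ∈ ({e} : Set β)) hef.symm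
  rcases hC with hC | hC | hC | hC
  · have h1 := (Ω.isCycleSet_of_balanced C hC).eq_singleton he hex
    exact absurd (h1 ▸ hf : f ∈ ({e} : Set β)) hef.symm
  · obtain ⟨C₁, C₂, h1, h2, -, -, rfl⟩ := hC
    rcases key C₁ C₂ h1 h2 he hf with ⟨rfl, rfl⟩ | ⟨rfl, rfl⟩
    · exact absurd singleton_union hne
    · exact absurd union_singleton hne
  · obtain ⟨C₁, C₂, x', y', U, P, h1, h2, -, hP, hU1, hU2, rfl⟩ := hC
    rcases key C₁ C₂ h1 h2 (he.resolve_right fun h => hP.ne_of_isLink h hex rfl)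
      (hf.resolve_right fun h => hP.ne_of_isLink h hfy rfl) with ⟨rfl, rfl⟩ | ⟨rfl, rfl⟩
    · rw [Graph.verts_singleton_of_isLoopAt hex] at hU1
      rw [Graph.verts_singleton_of_isLoopAt hfy] at hU2
      obtain rfl : x' = x := (hU1 ▸ mem_singleton x' : x' ∈ U ∩ {x}).2
      obtain rfl : y' = y := (hU2 ▸ mem_singleton y' : y' ∈ U ∩ {y}).2
      exact ⟨U, P, hP, by rw [singleton_union]⟩
    · rw [Graph.verts_singleton_of_isLoopAt hex] at hU2
      rw [Graph.verts_singleton_of_isLoopAt hfy] at hU1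
      obtain rfl : y' = x := (hU2 ▸ mem_singleton y' : y' ∈ U ∩ {x}).2
      obtain rfl : x' = y := (hU1 ▸ mem_singleton x' : x' ∈ U ∩ {y}).2
      exact ⟨U, P, hP.reverse, by rw [union_singleton]⟩
  · obtain ⟨P₁, P₂, P₃, hth, -, -, -, rfl⟩ := hC
    exact absurd rfl (hth.ne_of_isLink he hex)

/-- If an unbalanced loop and two links form a circuit of the frame matroid, then the links meet
the vertex of the loop. -/
lemma IsFrameCircuit.inc_of_triple {e f g : β} (hC : Ω.IsFrameCircuit {e, f, g}) {x : α}
    (hef : e ≠ f) (heg : e ≠ g) (hfg : f ≠ g) (hex : Ω.graph.IsLink e x x)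
    (hf : ∀ z, ¬ Ω.graph.IsLink f z z) (hg : ∀ z, ¬ Ω.graph.IsLink g z z) :
    Ω.graph.Inc f x ∧ Ω.graph.Inc g x := by
  have tight : ∀ C₁ C₂ : Set β, Ω.IsUnbalancedCycle C₁ → Ω.IsUnbalancedCycle C₂ →
      Disjoint C₁ C₂ → (∃ v, Ω.graph.verts C₁ ∩ Ω.graph.verts C₂ = {v}) →
      {e, f, g} = C₁ ∪ C₂ → e ∈ C₁ → Ω.graph.Inc f x ∧ Ω.graph.Inc g x := by
    rintro C₁ C₂ h1 h2 hdj ⟨v, hv⟩ hCe he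
    obtain rfl := h1.1.eq_singleton he hex
    have hC2 : C₂ = {f, g} := by
      rw [disjoint_singleton_left] at hdj
      ext a
      have := congrArg (a ∈ ·) hCe
      simp only [mem_insert_iff, mem_singleton_iff, mem_union, eq_iff_iff] at this ⊢
      -- The loop is one cycle of the handcuff, so the two links form the other: a digon through
      -- `x`.
      grind
    subst hC2
    obtain ⟨u, w, hfu, hgu⟩ := h2.1.exists_isLink_pair hfg
    have hx : v ∈ Ω.graph.verts {e} ∩ Ω.graph.verts {f, g} := hv.symm ▸ mem_singleton v
    rw [Graph.verts_singleton_of_isLoopAt hex] at hx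
    obtain ⟨rfl, a, ha, b, hb⟩ := hx
    rcases ha with rfl | rfl
    · rcases hb.eq_and_eq_or_eq_and_eq hfu with ⟨rfl, rfl⟩ | ⟨rfl, rfl⟩
      · exact ⟨⟨_, hfu⟩, ⟨_, hgu⟩⟩
      · exact ⟨⟨_, hfu.symm⟩, ⟨_, hgu.symm⟩⟩
    · rcases hb.eq_and_eq_or_eq_and_eq hgu with ⟨rfl, rfl⟩ | ⟨rfl, rfl⟩
      · exact ⟨⟨_, hfu⟩, ⟨_, hgu⟩⟩
      · exact ⟨⟨_, hfu.symm⟩, ⟨_, hgu.symm⟩⟩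
  have loose : ∀ (C₁ C₂ : Set β) (x' y' : α) (U : Set α) (P : Set β), Ω.IsUnbalancedCycle C₁ →
      Ω.IsUnbalancedCycle C₂ → Disjoint (Ω.graph.verts C₁) (Ω.graph.verts C₂) →
      Ω.graph.IsPathBetween x' y' U P → U ∩ Ω.graph.verts C₁ = {x'} →
      U ∩ Ω.graph.verts C₂ = {y'} → {e, f, g} = C₁ ∪ C₂ ∪ P → e ∈ C₁ → False := by
    intro C₁ C₂ x' y' U P h1 h2 hdj hP hU1 hU2 hCe he
    obtain rfl := h1.1.eq_singleton he hex
    have heC2 : e ∉ C₂ := fun h =>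
      disjoint_left.1 hdj ⟨e, he, x, hex⟩ ⟨e, h, x, hex⟩
    have heP : e ∉ P := fun h => hP.ne_of_isLink h hex rfl
    have hsub : ∀ a ∈ C₂ ∪ P, a = f ∨ a = g := by
      intro a ha
      have h3 : a ∈ ({e, f, g} : Set β) := by
        rw [hCe, union_assoc]
        exact Or.inr ha
      refine h3.resolve_left ?_
      rintro rfl
      exact ha.elim heC2 heP
    -- As `f` and `g` are not loops, the second cycle needs both. This leaves no edge for the
    -- connecting path, so the two cycles would share a vertex.
    have hC2 : C₂ = {f, g} := by
      obtain ⟨-, -, -, Q, a, -, -, -, hQ⟩ := h2.1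
      have haC : a ∈ C₂ := hQ ▸ mem_insert _ _
      refine Subset.antisymm (fun b hb => hsub b (Or.inl hb)) ?_
      by_contra hnot
      have h4 : C₂ = {f} ∨ C₂ = {g} := by
        rw [insert_subset_iff, singleton_subset_iff] at hnot
        have h5 := hsub a (Or.inl haC)
        by_cases hfC : f ∈ C₂
        · left
          ext b
          have := hsub b
          simp only [mem_union, mem_singleton_iff] at this ⊢
          grind
        · right
          ext b
          have := hsub b
          simp only [mem_union, mem_singleton_iff] at this ⊢
          grind
      rcases h4 with rfl | rfl
      · obtain ⟨z, hz⟩ := h2.1.exists_isLoopAt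
        exact hf z hz
      · obtain ⟨z, hz⟩ := h2.1.exists_isLoopAt
        exact hg z hz
    have hPe : P = ∅ := by
      refine eq_empty_of_forall_notMem fun a ha => ?_
      have haC : a ∈ C₂ := hC2 ▸ hsub a (Or.inr ha)
      obtain ⟨z, w, hzw⟩ := Ω.graph.exists_isLink_of_mem_edgeSet (hP.mem_edgeSet ha)
      obtain ⟨hz, hw⟩ := hP.mem_of_isLink ha hzw
      have h5 : z = y' := (hU2 ▸ ⟨hz, a, haC, w, hzw⟩ : z ∈ ({y'} : Set α))
      have h6 : w = y' := (hU2 ▸ ⟨hw, a, haC, z, hzw.symm⟩ : w ∈ ({y'} : Set α))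
      exact hP.ne_of_isLink ha hzw (h5.trans h6.symm)
    subst hPe
    obtain rfl := hP.eq_of_empty
    exact disjoint_left.1 hdj (hU1 ▸ mem_singleton x' : x' ∈ U ∩ _).2
      (hU2 ▸ mem_singleton x' : x' ∈ U ∩ _).2
  have heC : e ∈ ({e, f, g} : Set β) := mem_insert _ _
  rcases hC with hC | hC | hC | hC
  · have h1 := (Ω.isCycleSet_of_balanced _ hC).eq_singleton heC hex
    have h2 : f ∈ ({e, f, g} : Set β) := by simp
    exact absurd (h1 ▸ h2 : f ∈ ({e} : Set β)) hef.symm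
  · obtain ⟨C₁, C₂, h1, h2, hdj, hv, hCe⟩ := hC
    rcases (hCe ▸ heC : e ∈ C₁ ∪ C₂) with he | he
    · exact tight C₁ C₂ h1 h2 hdj hv hCe he
    · exact tight C₂ C₁ h2 h1 hdj.symm (by rwa [inter_comm]) (by rwa [union_comm]) he
  · obtain ⟨C₁, C₂, x', y', U, P, h1, h2, hdj, hP, hU1, hU2, hCe⟩ := hC
    exfalso
    rcases (hCe ▸ heC : e ∈ C₁ ∪ C₂ ∪ P) with (he | he) | he
    · exact loose C₁ C₂ x' y' U P h1 h2 hdj hP hU1 hU2 hCe he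
    · exact loose C₂ C₁ y' x' U P h2 h1 hdj.symm hP.reverse hU2 hU1
        (by rwa [union_comm C₂]) he
    · exact hP.ne_of_isLink he hex rfl
  · obtain ⟨P₁, P₂, P₃, hth, -, -, -, hCe⟩ := hC
    exact absurd rfl (hth.ne_of_isLink (hCe ▸ heC) hex)

end BiasedGraph

lemma not_isFrame_matroidalEight : ¬ matroidalEight.IsFrame := by
  rintro ⟨V, Ω, ⟨-, hrep⟩, hL⟩
  obtain ⟨⟨x, hx⟩, -⟩ := hL (.inl 0) (Or.inl rfl)
  obtain ⟨⟨y, hy⟩, -⟩ := hL (.inl 2) (Or.inr rfl)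
  have hpath : ∀ S : Finset (Fin 4 ⊕ Fin 4), .inl 0 ∈ S → .inl 2 ∈ S → S ≠ {.inl 0, .inl 2} →
      ∑ e ∈ S, wheelVec e = 0 →
      (∀ T ⊆ S, .inl 0 ∉ T → ∑ e ∈ T, wheelVec e = 0 → T = ∅) →
      ∃ U, Ω.graph.IsPathBetween x y U (S \ {.inl 0, .inl 2} : Finset (Fin 4 ⊕ Fin 4)) := by
    intro S h0 h2 hne hsum hmin
    have hC := (hrep _).1 (matroidalEight_isCircuit h0 hsum hmin)
    obtain ⟨U, P, hP, hSP⟩ := hC.exists_path (by decide) h0 h2 hx hy (by exact_mod_cast hne)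
    refine ⟨U, ?_⟩
    convert hP
    have hd : Disjoint P {.inl 0, .inl 2} := by
      rw [disjoint_right]
      rintro a (rfl | rfl) ha
      · exact hP.ne_of_isLink ha hx rfl
      · exact hP.ne_of_isLink ha hy rfl
    push_cast
    rw [hSP, union_sdiff_left, hd.sdiff_eq_left]
  -- The rim and the two 5-cycles through the hub that contain both distinguished edges. The
  -- remaining edges of each form a path from `x` to `y`; every spoke lies on one of these paths and
  -- so is not a loop.
  obtain ⟨U₁, h₁⟩ := hpath {.inl 0, .inl 1, .inl 2, .inl 3} (by decide) (by decide) (by decide)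
    (by decide +kernel) (by decide +kernel)
  obtain ⟨U₂, h₂⟩ := hpath {.inl 0, .inl 1, .inl 2, .inr 0, .inr 3} (by decide) (by decide)
    (by decide) (by decide +kernel) (by decide +kernel)
  obtain ⟨U₃, h₃⟩ := hpath {.inl 0, .inl 2, .inl 3, .inr 1, .inr 2} (by decide) (by decide)
    (by decide) (by decide +kernel) (by decide +kernel)
  have hlink : ∀ i z, ¬ Ω.graph.IsLink (.inr i) z z := by
    intro i z hz
    have hi : (i = 0 ∨ i = 3) ∨ (i = 1 ∨ i = 2) := by
      clear hz
      revert i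
      decide
    rcases hi with hi | hi
    · exact h₂.ne_of_isLink (by rcases hi with rfl | rfl <;> decide) hz rfl
    · exact h₃.ne_of_isLink (by rcases hi with rfl | rfl <;> decide) hz rfl
  have htri : ∀ (a : Fin 4 ⊕ Fin 4) (i j : Fin 4) (z : V), Ω.graph.IsLink a z z →
      a ≠ .inr i → a ≠ .inr j → i ≠ j →
      ∑ e ∈ {a, .inr i, .inr j}, wheelVec e = 0 →
      (∀ T ⊆ {a, .inr i, .inr j}, a ∉ T → ∑ e ∈ T, wheelVec e = 0 → T = ∅) →
      Ω.graph.Inc (.inr i) z ∧ Ω.graph.Inc (.inr j) z := by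
    intro a i j z hz hai haj hij hsum hmin
    have hC := (hrep _).1 (matroidalEight_isCircuit (Finset.mem_insert_self _ _) hsum hmin)
    push_cast at hC
    exact hC.inc_of_triple hai haj (by simpa using hij) hz (hlink i) (hlink j)
  -- The triangles of the wheel on `inl 0` and on `inl 2` attach their spokes to `x` and to `y`.
  have hs0 := (htri (.inl 0) 0 1 x hx (by decide) (by decide) (by decide) (by decide +kernel)
    (by decide +kernel)).1
  have hs3 := (htri (.inl 2) 3 2 y hy (by decide) (by decide) (by decide) (by decide +kernel)
    (by decide +kernel)).1
  have hpair : (({.inl 0, .inl 1, .inl 2, .inl 3} \ {.inl 0, .inl 2} : Finset (Fin 4 ⊕ Fin 4)) :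
      Set (Fin 4 ⊕ Fin 4)) = {.inl 1, .inl 3} := by
    rw [show ({.inl 0, .inl 1, .inl 2, .inl 3} \ {.inl 0, .inl 2} : Finset (Fin 4 ⊕ Fin 4)) =
      {.inl 1, .inl 3} by decide]
    push_cast
    rfl
  rw [hpair] at h₁
  -- Wherever `inl 1` ends, it shares an end of the path `h₂` with `inr 0` (at `x`) or with `inr 3`
  -- (at `y`).
  rcases h₁.inc_of_pair (by decide) with h | h
  · exact absurd (h₂.eq_of_inc_left (by decide) (by decide) h hs0) (by decide)
  · exact absurd (h₂.eq_of_inc_right (by decide) (by decide) h hs3) (by decide)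

theorem mainTheorem11 : matroidalEight.IsExcludedMinor := by
  refine ⟨fun e _ he => wheelVec_ne_zero e ?_, not_isFrame_matroidalEight,
    fun B hB hne hBl => ?_⟩
  · exact (isBinaryRep_matroidalEight.isLoop_iff (mem_univ e)).1 he
  -- A proper minor has a first step, after which a root exists and persists. Loop-freeness is
  -- needed only for the final matroidal, not along the way.
  · rcases Relation.ReflTransGen.cases_head hB with rfl | ⟨A, hA, hAB⟩
    · exact absurd rfl hne
    · exact ((isStarGraphic_of_step hA).isMinor hAB).isFrame hBl
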